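/- **Theorem (Uniform point-wise approximation of the risk).** *Setting.* For $i=1,2,\dots$ let $\theta_i\in\mathbb R$, $b_i,h_i>0$ and $\sigma_{p,i},\sigma_{f,i}>0$; put $\tilde b_i=b_i/(b_i+h_i)$. Write $N(\mu,\sigma)$ for the normal law with mean $\mu$ and variance $\sigma$, and $\phi,\Phi$ for the standard normal density and distribution function. For each $n$ let $X=(X_1,\dots,X_n)$ have independent coordinates $X_i\sim N(\theta_i,\sigma_{p,i})$. For $\tau\in[0,\infty]$ let $\alpha_i(\tau)=\tau/(\tau+\sigma_{p,i})$ (with $\alpha_i(\infty)=1$), and let the origin-centric class $\mathcal S^0$ consist of the estimators $\hat q(\tau)$, $\tau\in[0,\infty]$, with coordinates $$\hat q_i(\tau)=\alpha_i(\tau)X_i+\sqrt{\sigma_{f,i}+\alpha_i(\tau)\sigma_{p,i}}\;\Phi^{-1}(\tilde b_i).$$ The predictive risk is $$R_n(\theta,\hat q)=\mathbb E_X\Big[\tfrac1n\sum_{i=1}^n l_i(\theta_i,\hat q_i(X))\Big],\qquad l_i(\theta_i,q)=\mathbb E_{Y\sim N(\theta_i,\sigma_{f,i})}\big[b_i(Y-q)^++h_i(q-Y)^+\big].$$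 *Assumptions.* - (A1) $0<\inf_i\tilde b_i\le\sup_i\tilde b_i<1$ and $\sup_i(b_i+h_i)<\infty$. - (A2) $\limsup_{n}\frac1n\sum_{i=1}^n|\theta_i|<\infty$. - (A3) $\sup_i\sigma_{p,i}/\sigma_{f,i}<1/(4e)$, $\sup_i\sigma_{f,i}<\infty$ and $\inf_i\sigma_{p,i}>0$. *The estimate $\widehat{\mathrm{ARE}}_n$.* Let $G(w,\beta)=\phi(w)+w\Phi(w)-\beta w$, with $G'$ its derivative in $w$, let $H_k$ be the probabilists' Hermite polynomials, and let $$c_i(\tau)=\sqrt{\frac{\sigma_{f,i}+\alpha_i(\tau)\sigma_{p,i}}{\sigma_{f,i}+\alpha_i(\tau)^2\sigma_{p,i}}}\;\Phi^{-1}(\tilde b_i),\qquad d_i(\tau)=-\frac{1-\alpha_i(\tau)}{\sqrt{\sigma_{f,i}+\sigma_{p,i}\alpha_i(\tau)^2}}.$$ Fix constants $\gamma(i)$ with $\inf_i\gamma(i)>0$ and $\gamma(i)<1/\sqrt{4e}-\sqrt{\sigma_{p,i}/\sigma_{f,i}}$ for every $i$, and set $$\lambda_n(i)=\gamma(i)\sqrt{2\log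 n},\qquad K_n(i)=1+\Big\lceil e^2\big(\gamma(i)+\sqrt{2\sigma_{p,i}/\sigma_{f,i}}\big)^2(2\log n)\Big\rceil .$$ With $s=s_i(\tau)=2\sigma_{p,i}d_i(\tau)^2$, let $$S_i(u)=G(0,\tilde b_i)+G'(0,\tilde b_i)\,u+\phi(0)\sum_{k=0}^{K_n(i)-2}\frac{(-1)^kH_k(0)}{(k+2)!}\,s^{(k+2)/2}H_{k+2}\big(u/\sqrt{s}\big),$$ where $s^{m/2}H_m(u/\sqrt s)$, a polynomial in $u$ and $s$, is read as $u^m$ when $s=0$ (i.e. $\tau=\infty$), and let $\tilde S_i(u)=\mathrm{sign}(S_i(u))\min\{|S_i(u)|,n\}$. Let $Z_i\sim N(0,1)$ be independent of each other and of $X$, let $U_i(\tau)=c_i(\tau)+d_i(\tau)(X_i+\sqrt{\sigma_{p,i}}Z_i)$ and $V_i(\tau)=c_i(\tau)+d_i(\tau)(X_i-\sqrt{\sigma_{p,i}}Z_i)$, and let $$\hat T_i(X_i,Z_i,\tau)=\begin{cases}-\tilde b_i\,U_i(\tau)&\text{if }V_i(\tau)<-\lambda_n(i),\\ \tilde S_i(U_i(\tau))&\text{if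 }-\lambda_n(i)\le V_i(\tau)\le\lambda_n(i),\\ (1-\tilde b_i)\,U_i(\tau)&\text{if }V_i(\tau)>\lambda_n(i).\end{cases}$$ Finally let $\hat T_i(X_i,\tau)=\mathbb E[\hat T_i(X_i,Z_i,\tau)\mid X]$ and $$\widehat{\mathrm{ARE}}_n(\tau)=\frac1n\sum_{i=1}^n(b_i+h_i)\sqrt{\sigma_{f,i}+\sigma_{p,i}\alpha_i(\tau)^2}\;\hat T_i(X_i,\tau).$$ *Conclusion.* Under (A1)–(A3), with $a_n=\log\log n$, $$\lim_{n\to\infty}a_n^8\,\sup_{\tau\in[0,\infty]}\mathbb E\Big[\big(\widehat{\mathrm{ARE}}_n(\tau)-R_n(\theta,\hat q(\tau))\big)^2\Big]=0,$$ the expectation being over $X$. -/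

import Mathlib

open MeasureTheory ProbabilityTheory Filter Topology
open scoped NNReal ENNReal

noncomputable section

namespace CheckLoss

/-- Standard normal density. -/
def stdPdf (w : ℝ) : ℝ := gaussianPDFReal 0 1 w

/-- Standard normal distribution function. -/
def stdCdf (w : ℝ) : ℝ := cdf (gaussianReal 0 1) w

/-- Standard normal quantile function, the inverse of `stdCdf` on `(0, 1)`. -/
def stdQuantile (p : ℝ) : ℝ := sInf {w : ℝ | p ≤ stdCdf w}

/-- `G(w, β) = φ(w) + w Φ(w) - β w`. -/
def G (w β : ℝ) : ℝ := stdPdf w + w * stdCdf w - β * w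

/-- The known data of one coordinate: under-estimation weight `b`, over-estimation weight `h`,
variance `sp` of the past observation and variance `sf` of the future observation. -/
structure Coord where
  b : ℝ
  h : ℝ
  sp : ℝ≥0
  sf : ℝ≥0
  b_pos : 0 < b
  h_pos : 0 < h
  sp_pos : 0 < sp
  sf_pos : 0 < sf

namespace Coord

variable (C : Coord)

/-- The critical ratio `b / (b + h)`. -/
def ratio : ℝ := C.b / (C.b + C.h)

/-- The predictive check loss `E_{Y ∼ N(θ, sf)} [b (Y - q)⁺ + h (q - Y)⁺]`. -/
def loss (θ q : ℝ) : ℝ :=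
  ∫ y, (C.b * max (y - q) 0 + C.h * max (q - y) 0) ∂(gaussianReal θ C.sf)

/-- The shrinkage factor `τ / (τ + sp)` for `τ ∈ [0, ∞]`, with value `1` at `τ = ∞`. -/
def shrink (τ : ℝ≥0∞) : ℝ := if τ = ∞ then 1 else τ.toReal / (τ.toReal + C.sp)

/-- The origin-centric shrinkage estimate as a function of the past observation `x`. -/
def est (τ : ℝ≥0∞) (x : ℝ) : ℝ :=
  C.shrink τ * x + √((C.sf : ℝ) + C.shrink τ * C.sp) * stdQuantile C.ratio

/-- The intercept of the affine map `θ ↦ c + d θ` in the risk `(b + h) √(sf + α² sp) G(c + d θ)`. -/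
def c (τ : ℝ≥0∞) : ℝ :=
  √(((C.sf : ℝ) + C.shrink τ * C.sp) / ((C.sf : ℝ) + C.shrink τ ^ 2 * C.sp)) *
    stdQuantile C.ratio

/-- The slope of that affine map; it vanishes at `τ = ∞`. -/
def d (τ : ℝ≥0∞) : ℝ :=
  -((1 - C.shrink τ) / √((C.sf : ℝ) + C.sp * C.shrink τ ^ 2))

end Coord

/-- Probabilists' Hermite polynomial as a real function. -/
def herm (k : ℕ) (x : ℝ) : ℝ := Polynomial.aeval x (Polynomial.hermite k)

/-- `s^{k/2} H_k(u / √s)`. This is a polynomial in `u` and `s`; its value at `s = 0` is `u ^ k`. -/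
def scaledHerm (k : ℕ) (s u : ℝ) : ℝ :=
  if s = 0 then u ^ k else √s ^ k * herm k (u / √s)

namespace Coord

variable (C : Coord)

/-- The threshold `γ √(2 log n)`. -/
def thr (γ : ℝ) (n : ℕ) : ℝ := γ * √(2 * Real.log n)

/-- The truncation order `1 + ⌈e² (γ + √(2 sp / sf))² (2 log n)⌉`. -/
def order (γ : ℝ) (n : ℕ) : ℕ :=
  1 + ⌈Real.exp 1 ^ 2 * (γ + √(2 * C.sp / C.sf)) ^ 2 * (2 * Real.log n)⌉₊

/-- The Hermite polynomial estimate `S`. -/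
def S (γ : ℝ) (n : ℕ) (τ : ℝ≥0∞) (u : ℝ) : ℝ :=
  G 0 C.ratio + deriv (fun w => G w C.ratio) 0 * u +
    stdPdf 0 * ∑ k ∈ Finset.range (C.order γ n - 1),
      (-1) ^ k * herm k 0 / ((k + 2).factorial : ℝ) *
        scaledHerm (k + 2) (2 * C.sp * C.d τ ^ 2) u

/-- `S` truncated to absolute value at most `n`. -/
def STrunc (γ : ℝ) (n : ℕ) (τ : ℝ≥0∞) (u : ℝ) : ℝ :=
  Real.sign (C.S γ n τ u) * min |C.S γ n τ u| n

/-- The randomized threshold estimate, with past observation `x` and added noise `z`. -/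
def TRand (γ : ℝ) (n : ℕ) (τ : ℝ≥0∞) (x z : ℝ) : ℝ :=
  let u := C.c τ + C.d τ * (x + √(C.sp : ℝ) * z)
  let v := C.c τ + C.d τ * (x - √(C.sp : ℝ) * z)
  if v < -thr γ n then -C.ratio * u
  else if v ≤ thr γ n then C.STrunc γ n τ u
  else (1 - C.ratio) * u

/-- The Rao-Blackwellized estimate: the noise `z ∼ N(0, 1)`, independent of the observations,
is integrated out. -/
def T (γ : ℝ) (n : ℕ) (τ : ℝ≥0∞) (x : ℝ) : ℝ :=
  ∫ z, C.TRand γ n τ x z ∂(gaussianReal 0 1)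

end Coord

/-- The law of the past data `X ∼ N(θ, diag(sp))` of the first `n` coordinates. -/
def pastLaw (M : ℕ → Coord) (θ : ℕ → ℝ) (n : ℕ) : Measure (Fin n → ℝ) :=
  Measure.pi fun i : Fin n => gaussianReal (θ i) (M i).sp

/-- The average predictive loss `L_n(θ, q)`. -/
def avgLoss (M : ℕ → Coord) (θ : ℕ → ℝ) (n : ℕ) (q : Fin n → ℝ) : ℝ :=
  (1 / n : ℝ) * ∑ i : Fin n, (M i).loss (θ i) (q i)

/-- The predictive risk `R_n(θ, q̂) = E_{X ∼ N(θ, diag(sp))} [L_n(θ, q̂(X))]`. -/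
def risk (M : ℕ → Coord) (θ : ℕ → ℝ) (n : ℕ) (q : (Fin n → ℝ) → Fin n → ℝ) : ℝ :=
  ∫ x, avgLoss M θ n (q x) ∂(pastLaw M θ n)

/-- The estimator `q̂(τ)`; the class of origin-centric estimators is its range over
`τ ∈ [0, ∞]`. -/
def originEst (M : ℕ → Coord) (n : ℕ) (τ : ℝ≥0∞) (x : Fin n → ℝ) : Fin n → ℝ :=
  fun i => (M i).est τ (x i)

/-- The asymptotic risk estimate at the data `x`. -/
def ARE (M : ℕ → Coord) (γ : ℕ → ℝ) (n : ℕ) (τ : ℝ≥0∞) (x : Fin n → ℝ) : ℝ :=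
  (1 / n : ℝ) * ∑ i : Fin n,
    ((M i).b + (M i).h) * √(((M i).sf : ℝ) + (M i).sp * (M i).shrink τ ^ 2) *
      (M i).T (γ i) n τ (x i)

/-- Bounded weights: `0 < inf b/(b+h)`, `sup b/(b+h) < 1` and `sup (b+h) < ∞`. -/
def BoundedWeights (M : ℕ → Coord) : Prop :=
  (∃ l : ℝ, 0 < l ∧ ∀ i, l ≤ (M i).ratio) ∧ (∃ r : ℝ, r < 1 ∧ ∀ i, (M i).ratio ≤ r) ∧
    ∃ B : ℝ, ∀ i, (M i).b + (M i).h ≤ B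

/-- Bounded average magnitude: `limsup (1/n) ∑ |θ_i| < ∞`. -/
def BoundedMeans (θ : ℕ → ℝ) : Prop :=
  limsup (fun n : ℕ => (((1 / n : ℝ) * ∑ i ∈ Finset.range n, |θ i| : ℝ) : EReal)) atTop < ⊤

/-- Sufficient historical data: `sup sp/sf < 1/(4e)`, `sup sf < ∞` and `inf sp > 0`. -/
def SufficientData (M : ℕ → Coord) : Prop :=
  (∃ r : ℝ, r < 1 / (4 * Real.exp 1) ∧ ∀ i, ((M i).sp / (M i).sf : ℝ) ≤ r) ∧
    (∃ B : ℝ, ∀ i, ((M i).sf : ℝ) ≤ B) ∧ ∃ l : ℝ, 0 < l ∧ ∀ i, l ≤ (M i).sp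

/-- Admissible threshold constants: bounded away from `0`, and
`γ_i < 1/√(4e) - √(sp/sf)` in each coordinate. -/
def AdmissibleThresholds (M : ℕ → Coord) (γ : ℕ → ℝ) : Prop :=
  (∃ l : ℝ, 0 < l ∧ ∀ i, l ≤ γ i) ∧
    ∀ i, γ i < 1 / √(4 * Real.exp 1) - √((M i).sp / (M i).sf : ℝ)

end CheckLoss

end

/-!
Since `q̂(τ) - Y` is normal, the risk in coordinate `i` is `(b + h) √(sf + α² sp) G(w, b̃)` at
`w = c + d θ`, so the task is to estimate `G` at an unknown mean. The rotation
`(X + √sp Z, X - √sp Z)` splits one observation into two independent variables, whence `U` and `V`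
are independent with the same law `N(w, 2 sp d²)`: `V` chooses the regime and `U` estimates within
it, so no selection effect has to be controlled.

Outside `[-λ, λ]` the linear branches differ from `G` by `E (±w + Z)⁺`, which is exponentially small
in `λ²` unless `V` lands in a tail on the wrong side of `w`, itself an unlikely event. Inside,
scaled Hermite polynomials estimate without bias the Taylor polynomial of `G` at `0`: the bound
`sp / sf < 1 / (4e)` keeps the second moment of this sum below `n ^ (3 / 4)` up to logarithms, while
the order `K` makes the Taylor remainder a negative power of `n`. When `|w|` exceeds a multiple of
`√(2 log n)` slightly larger than `γ`, the Taylor polynomial is useless, but then `V` falls between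
`-λ` and `λ` with probability at most `n ^ (-5 / 4)`, which beats the truncation level `n`.

Each coordinate thus has bias at most a negative power of `n` and second moment at most
`n ^ (3 / 4)`, up to logarithms. Averaging `n` independent coordinates divides the variances by `n`,
so the mean squared error decays polynomially in `n`, uniformly in `τ`, which beats any power of
`log log n`.
-/

namespace CheckLoss

section SquareIntegrable

variable {α ι : Type*} {mα : MeasurableSpace α} {μ : Measure α}

lemma integral_sum_sq_le (t : Finset ι) {f : ι → α → ℝ} (hf : ∀ i ∈ t, MemLp (f i) 2 μ) :
    ∫ x, (∑ i ∈ t, f i x) ^ 2 ∂μ ≤ t.card * ∑ i ∈ t, ∫ x, f i x ^ 2 ∂μ := by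
  rw [← integral_finsetSum t fun i hi => (hf i hi).integrable_sq, ← integral_const_mul]
  exact integral_mono_of_nonneg (ae_of_all _ fun x => sq_nonneg _)
    ((integrable_finsetSum t fun i hi => (hf i hi).integrable_sq).const_mul _)
    (ae_of_all _ fun x => sq_sum_le_card_mul_sum_sq)

end SquareIntegrable

/-! ### The Gaussian law and Hermite polynomials -/

lemma stdPdf_eq (x : ℝ) : stdPdf x = stdPdf 0 * Real.exp (-(x ^ 2 / 2)) := by
  simp only [stdPdf, gaussianPDFReal, sub_zero, NNReal.coe_one, mul_one]
  norm_num [neg_div]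

lemma hasDerivAt_stdPdf (x : ℝ) : HasDerivAt stdPdf (-(x * stdPdf x)) x := by
  have h : HasDerivAt (fun x : ℝ => -(x ^ 2 / 2)) (-x) x := by
    simpa using ((hasDerivAt_pow 2 x).div_const 2).fun_neg
  rw [funext stdPdf_eq]
  convert! h.exp.const_mul (stdPdf 0) using 1
  ring

section Hermite

open Polynomial

lemma memLp_eval_gaussianReal (p : ℝ[X]) (m : ℝ) (v : ℝ≥0) :
    MemLp (fun x => p.eval x) 2 (gaussianReal m v) := by
  have h_pow (k : ℕ) : Integrable (fun x : ℝ => x ^ k) (gaussianReal m v) := by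
    rcases eq_or_ne k 0 with rfl | hk
    · simp
    · have h := (memLp_id_gaussianReal (μ := m) (v := v) k).integrable_norm_pow hk
      exact h.mono (by fun_prop) (ae_of_all _ fun x => by simp)
  rw [memLp_two_iff_integrable_sq (by fun_prop)]
  simp_rw [← eval_pow, eval_eq_sum_range]
  exact integrable_finsetSum _ fun k _ => (h_pow k).const_mul _

lemma integrable_eval_gaussianReal (p : ℝ[X]) (m : ℝ) (v : ℝ≥0) :
    Integrable (fun x => p.eval x) (gaussianReal m v) :=
  (memLp_eval_gaussianReal p m v).integrable one_le_two

lemma integrable_stdPdf_mul_eval (p : ℝ[X]) : Integrable (fun x => stdPdf x * p.eval x) := by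
  have h := integrable_eval_gaussianReal p 0 1
  rw [gaussianReal_of_var_ne_zero 0 one_ne_zero,
    integrable_withDensity_iff_integrable_smul' (measurable_gaussianPDF 0 1)
      (ae_of_all _ fun x => gaussianPDF_lt_top)] at h
  simpa only [toReal_gaussianPDF, smul_eq_mul, stdPdf] using h

lemma integral_gaussianReal_zero_one (f : ℝ → ℝ) :
    ∫ x, f x ∂(gaussianReal 0 1) = ∫ x, stdPdf x * f x :=
  integral_gaussianReal_eq_integral_smul one_ne_zero

-- Integration by parts, since `φ' = -x φ`.
lemma integral_mul_eval_gaussianReal (p : ℝ[X]) :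
    ∫ x, x * p.eval x ∂(gaussianReal 0 1) = ∫ x, (derivative p).eval x ∂(gaussianReal 0 1) := by
  have h := integral_mul_deriv_eq_deriv_mul_of_integrable (fun x _ => p.hasDerivAt x)
    (fun x _ => hasDerivAt_stdPdf x)
    ((integrable_stdPdf_mul_eval (-(X * p))).congr
      (ae_of_all _ fun x => by simp only [eval_neg, eval_mul, eval_X, Pi.mul_apply]; ring))
    ((integrable_stdPdf_mul_eval (derivative p)).congr (ae_of_all _ fun x => mul_comm _ _))
    ((integrable_stdPdf_mul_eval p).congr (ae_of_all _ fun x => mul_comm _ _))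
  simp only [mul_neg, integral_neg, neg_inj] at h
  rw [integral_gaussianReal_zero_one, integral_gaussianReal_zero_one]
  simpa only [mul_comm, mul_left_comm, mul_assoc] using h

/-- The probabilists' Hermite polynomial with real coefficients; `herm k` is its evaluation
(`herm_eq_eval`). -/
noncomputable def hermitePoly (k : ℕ) : ℝ[X] := (hermite k).map (Int.castRingHom ℝ)

lemma herm_eq_eval (k : ℕ) (x : ℝ) : herm k x = (hermitePoly k).eval x := by
  simp [herm, hermitePoly, aeval_def, eval_map]

lemma hermitePoly_zero : hermitePoly 0 = 1 := by simp [hermitePoly]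

lemma hermitePoly_succ (k : ℕ) :
    hermitePoly (k + 1) = X * hermitePoly k - derivative (hermitePoly k) := by
  simp [hermitePoly, hermite_succ]

lemma natDegree_hermitePoly (k : ℕ) : (hermitePoly k).natDegree = k := by
  rw [hermitePoly, (hermite_monic k).natDegree_map, natDegree_hermite]

lemma derivative_hermitePoly (k : ℕ) :
    derivative (hermitePoly k) = k • hermitePoly (k - 1) := by
  induction k with
  | zero => simp [hermitePoly_zero]
  | succ k ih =>
    have h : (k : ℝ[X]) * hermitePoly k =
        (k : ℝ[X]) * (X * hermitePoly (k - 1) - derivative (hermitePoly (k - 1))) := by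
      cases k <;> simp [hermitePoly_succ]
    rw [hermitePoly_succ, derivative_sub, derivative_mul, ih]
    simp only [nsmul_eq_mul, derivative_X, derivative_mul, derivative_natCast, Nat.cast_add,
      Nat.cast_one, Nat.add_sub_cancel]
    linear_combination -h

lemma iterate_derivative_hermitePoly (n k : ℕ) :
    derivative^[k] (hermitePoly n) = n.descFactorial k • hermitePoly (n - k) := by
  induction k with
  | zero => simp
  | succ k ih =>
    rw [Function.iterate_succ_apply', ih, derivative_smul, derivative_hermitePoly, smul_smul,
      Nat.descFactorial_succ, mul_comm, Nat.sub_sub]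

lemma hasseDeriv_hermitePoly (n k : ℕ) :
    hasseDeriv k (hermitePoly n) = n.choose k • hermitePoly (n - k) := by
  refine nsmul_right_injective k.factorial_ne_zero ?_
  have h := congrFun (factorial_smul_hasseDeriv (R := ℝ) k) (hermitePoly n)
  simpa only [LinearMap.smul_apply, iterate_derivative_hermitePoly, smul_smul,
    Nat.descFactorial_eq_factorial_mul_choose] using h

lemma herm_zero (x : ℝ) : herm 0 x = 1 := by simp [herm]

lemma herm_one (x : ℝ) : herm 1 x = x := by simp [herm]

lemma herm_add (m : ℕ) (x a : ℝ) :
    herm m (x + a) = ∑ k ∈ Finset.range (m + 1), (m.choose k : ℝ) * herm (m - k) x * a ^ k := by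
  have h_deg : (taylor x (hermitePoly m)).natDegree < m + 1 := by
    rw [natDegree_taylor, natDegree_hermitePoly]
    exact m.lt_succ_self
  rw [herm_eq_eval, add_comm, ← taylor_eval, eval_eq_sum_range' h_deg]
  simp only [taylor_coeff, hasseDeriv_hermitePoly, herm_eq_eval, nsmul_eq_mul, eval_mul,
    eval_natCast]

lemma memLp_herm (k : ℕ) : MemLp (herm k) 2 (gaussianReal 0 1) := by
  simpa only [← herm_eq_eval] using memLp_eval_gaussianReal (hermitePoly k) 0 1

-- Iterated integration by parts, using `H_{k+1} = x H_k - H_k'`.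
lemma integral_herm_mul_eval (k : ℕ) (p : ℝ[X]) :
    ∫ x, herm k x * p.eval x ∂(gaussianReal 0 1) =
      ∫ x, (derivative^[k] p).eval x ∂(gaussianReal 0 1) := by
  induction k generalizing p with
  | zero => simp [herm_zero]
  | succ k ih =>
    have h_parts := integral_mul_eval_gaussianReal (hermitePoly k * p)
    have h_split := integral_sub (integrable_eval_gaussianReal (X * (hermitePoly k * p)) 0 1)
      (integrable_eval_gaussianReal (derivative (hermitePoly k) * p) 0 1)
    have h_prod := integral_add
      (integrable_eval_gaussianReal (derivative (hermitePoly k) * p) 0 1)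
      (integrable_eval_gaussianReal (hermitePoly k * derivative p) 0 1)
    rw [Function.iterate_succ_apply, ← ih (derivative p)]
    simp only [herm_eq_eval, hermitePoly_succ, derivative_mul, eval_mul, eval_add, eval_sub,
      eval_X, sub_mul, mul_assoc] at h_parts h_split h_prod ⊢
    linarith

lemma integral_herm (k : ℕ) :
    ∫ x, herm k x ∂(gaussianReal 0 1) = if k = 0 then 1 else 0 := by
  cases k with
  | zero => simp [herm_zero]
  | succ k => simpa [Function.iterate_succ_apply] using integral_herm_mul_eval (k + 1) 1

lemma integral_herm_sq (k : ℕ) : ∫ x, herm k x ^ 2 ∂(gaussianReal 0 1) = k.factorial := by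
  simpa [← herm_eq_eval, sq, iterate_derivative_hermitePoly, Nat.descFactorial_self, herm_zero]
    using integral_herm_mul_eval k (hermitePoly k)

end Hermite

lemma map_add_mul_gaussianReal (m : ℝ) (v : ℝ≥0) (a b : ℝ) :
    (gaussianReal m v).map (fun x => a + b * x) =
      gaussianReal (a + b * m) (.mk (b ^ 2) (sq_nonneg b) * v) := by
  rw [show (fun x => a + b * x) = (fun x => a + x) ∘ fun x => b * x from rfl,
    ← Measure.map_map (by fun_prop) (by fun_prop), gaussianReal_map_const_mul,
    gaussianReal_map_const_add, add_comm]

lemma map_add_sqrt_mul_gaussianReal (w : ℝ) (s : ℝ≥0) :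
    (gaussianReal 0 1).map (fun z => w + √(s : ℝ) * z) = gaussianReal w s := by
  rw [map_add_mul_gaussianReal]
  congr 1
  · simp
  · rw [mul_one]
    ext
    exact Real.sq_sqrt s.coe_nonneg

lemma integral_gaussianReal_eq_standard (w : ℝ) (s : ℝ≥0) {f : ℝ → ℝ} (hf : Measurable f) :
    ∫ u, f u ∂(gaussianReal w s) = ∫ z, f (w + √(s : ℝ) * z) ∂(gaussianReal 0 1) := by
  rw [← map_add_sqrt_mul_gaussianReal w s,
    integral_map (by fun_prop) hf.aestronglyMeasurable]

section ScaledHermite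

lemma scaledHerm_zero (s u : ℝ) : scaledHerm 0 s u = 1 := by simp [scaledHerm, herm_zero]

lemma scaledHerm_one {s : ℝ} (hs : 0 ≤ s) (u : ℝ) : scaledHerm 1 s u = u := by
  rcases hs.eq_or_lt with rfl | hs
  · simp [scaledHerm]
  · rw [scaledHerm, if_neg hs.ne', pow_one, herm_one, mul_div_cancel₀ _ (Real.sqrt_pos.2 hs).ne']

open Polynomial in
lemma exists_eval_eq_scaledHerm (m : ℕ) (s : ℝ) : ∃ p : ℝ[X], (p.eval ·) = scaledHerm m s := by
  by_cases hs : s = 0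
  · exact ⟨X ^ m, funext fun u => by simp [scaledHerm, hs]⟩
  · refine ⟨C (√s ^ m) * (hermitePoly m).comp (C (√s)⁻¹ * X), funext fun u => ?_⟩
    simp [scaledHerm, hs, herm_eq_eval, div_eq_inv_mul]

lemma continuous_scaledHerm (m : ℕ) (s : ℝ) : Continuous (scaledHerm m s) := by
  obtain ⟨p, hp⟩ := exists_eval_eq_scaledHerm m s
  exact hp ▸ p.continuous

lemma memLp_scaledHerm (m : ℕ) (s w : ℝ) (v : ℝ≥0) :
    MemLp (scaledHerm m s) 2 (gaussianReal w v) := by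
  obtain ⟨p, hp⟩ := exists_eval_eq_scaledHerm m s
  exact hp ▸ memLp_eval_gaussianReal p w v

lemma scaledHerm_add_sqrt_mul (m : ℕ) {s : ℝ} (hs : 0 ≤ s) (w z : ℝ) :
    scaledHerm m s (w + √s * z) =
      ∑ k ∈ Finset.range (m + 1), (m.choose k : ℝ) * w ^ k * √s ^ (m - k) * herm (m - k) z := by
  rcases hs.eq_or_lt with rfl | hs
  · rw [Finset.sum_range_succ, Finset.sum_eq_zero fun k hk => ?_]
    · simp [scaledHerm, herm_zero]
    · simp [Nat.sub_ne_zero_of_lt (Finset.mem_range.1 hk)]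
  · have h_ne : √s ≠ 0 := (Real.sqrt_pos.2 hs).ne'
    rw [scaledHerm, if_neg hs.ne', show (w + √s * z) / √s = z + w / √s by field_simp; ring,
      herm_add, Finset.mul_sum]
    refine Finset.sum_congr rfl fun k hk => ?_
    rw [← pow_sub_mul_pow √s (Nat.lt_succ_iff.1 (Finset.mem_range.1 hk)), div_pow]
    field_simp

lemma integral_scaledHerm (m : ℕ) (w : ℝ) (s : ℝ≥0) :
    ∫ u, scaledHerm m s u ∂(gaussianReal w s) = w ^ m := by
  rw [integral_gaussianReal_eq_standard w s (continuous_scaledHerm m s).measurable]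
  simp only [scaledHerm_add_sqrt_mul m s.coe_nonneg]
  rw [integral_finsetSum _ fun k _ => ((memLp_herm _).integrable one_le_two).const_mul _,
    Finset.sum_range_succ, Finset.sum_eq_zero fun k hk => ?_]
  · simp [herm_zero]
  · rw [integral_const_mul, integral_herm,
      if_neg (Nat.sub_ne_zero_of_lt (Finset.mem_range.1 hk)), mul_zero]

lemma sq_choose_mul_pow_mul_factorial_le {s : ℝ} (hs : 0 ≤ s) (hs1 : s < 1) (w : ℝ) {m k : ℕ}
    (hk : k ≤ m) :
    ((m.choose k : ℝ) * w ^ k * √s ^ (m - k)) ^ 2 * (m - k).factorial ≤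
      m.factorial * Real.exp (w ^ 2 / (1 - s)) * ((1 - s) ^ k * s ^ (m - k) * m.choose k) := by
  have : 0 < 1 - s := by linarith
  have h_pow : (w ^ 2) ^ k ≤ Real.exp (w ^ 2 / (1 - s)) * ((1 - s) ^ k * k.factorial) := by
    have h := Real.pow_div_factorial_le_exp (w ^ 2 / (1 - s)) (by positivity) k
    rwa [div_pow, div_div, div_le_iff₀ (by positivity)] at h
  have h_fact : (m.factorial : ℝ) = m.choose k * k.factorial * (m - k).factorial := by
    exact_mod_cast (Nat.choose_mul_factorial_mul_factorial hk).symm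
  calc ((m.choose k : ℝ) * w ^ k * √s ^ (m - k)) ^ 2 * (m - k).factorial
      = (m.choose k : ℝ) ^ 2 * s ^ (m - k) * (m - k).factorial * (w ^ 2) ^ k := by
        rw [mul_pow, mul_pow, ← pow_mul √s, mul_comm (m - k) 2, pow_mul √s, Real.sq_sqrt hs]
        ring
    _ ≤ (m.choose k : ℝ) ^ 2 * s ^ (m - k) * (m - k).factorial *
          (Real.exp (w ^ 2 / (1 - s)) * ((1 - s) ^ k * k.factorial)) := by gcongr
    _ = _ := by rw [h_fact]; ring

lemma integral_scaledHerm_sq_le (m : ℕ) (w : ℝ) {s : ℝ≥0} (hs : s < 1) :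
    ∫ u, scaledHerm m s u ^ 2 ∂(gaussianReal w s) ≤
      (m + 1) * m.factorial * Real.exp (w ^ 2 / (1 - s)) := by
  rw [integral_gaussianReal_eq_standard w s (f := fun u => scaledHerm m s u ^ 2)
    ((continuous_scaledHerm m s).pow 2).measurable]
  simp only [scaledHerm_add_sqrt_mul m s.coe_nonneg]
  calc _ ≤ ((m + 1 : ℕ) : ℝ) * ∑ k ∈ Finset.range (m + 1),
        ((m.choose k : ℝ) * w ^ k * √s ^ (m - k)) ^ 2 * (m - k).factorial := by
        refine (integral_sum_sq_le _ fun k _ => (memLp_herm _).const_mul _).trans_eq ?_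
        simp only [Finset.card_range, mul_pow _ (herm _ _), integral_const_mul, integral_herm_sq]
    _ ≤ ((m + 1 : ℕ) : ℝ) * ∑ k ∈ Finset.range (m + 1),
        m.factorial * Real.exp (w ^ 2 / (1 - s)) * ((1 - s) ^ k * s ^ (m - k) * m.choose k) := by
        refine mul_le_mul_of_nonneg_left (Finset.sum_le_sum fun k hk => ?_) (Nat.cast_nonneg _)
        exact sq_choose_mul_pow_mul_factorial_le s.coe_nonneg (by exact_mod_cast hs) w
          (Nat.lt_succ_iff.1 (Finset.mem_range.1 hk))
    _ = _ := by
        rw [← Finset.mul_sum, ← add_pow, sub_add_cancel, one_pow]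
        push_cast
        ring

end ScaledHermite

/-! ### The check loss of a normal variable -/

lemma stdPdf_nonneg (x : ℝ) : 0 ≤ stdPdf x := gaussianPDFReal_nonneg _ _ _

lemma stdPdf_zero_sq_le : stdPdf 0 ^ 2 ≤ 1 / 6 := by
  have h : stdPdf 0 ^ 2 = 1 / (2 * Real.pi) := by
    simp [stdPdf, gaussianPDFReal, mul_pow, Real.sq_sqrt Real.pi_pos.le, mul_comm]
  rw [h]
  exact one_div_le_one_div_of_le (by norm_num) (by linarith [Real.pi_gt_three])

lemma stdPdf_zero_le_one : stdPdf 0 ≤ 1 := by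
  nlinarith [stdPdf_zero_sq_le, stdPdf_nonneg 0]

lemma stdPdf_le_exp (x : ℝ) : stdPdf x ≤ Real.exp (-(x ^ 2 / 2)) := by
  rw [stdPdf_eq]
  exact mul_le_of_le_one_left (Real.exp_pos _).le stdPdf_zero_le_one

lemma stdPdf_neg (x : ℝ) : stdPdf (-x) = stdPdf x := by
  rw [stdPdf_eq, stdPdf_eq x, neg_sq]

lemma continuous_stdPdf : Continuous stdPdf :=
  continuous_iff_continuousAt.2 fun x => (hasDerivAt_stdPdf x).continuousAt

lemma integrable_stdPdf : Integrable stdPdf := integrable_gaussianPDFReal 0 1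

lemma integrable_mul_stdPdf : Integrable fun x => x * stdPdf x :=
  (integrable_stdPdf_mul_eval Polynomial.X).congr
    (ae_of_all _ fun x => by simp only [Polynomial.eval_X, mul_comm])

lemma measureReal_gaussianReal_zero_one (t : Set ℝ) :
    (gaussianReal 0 1).real t = ∫ x in t, stdPdf x := by
  rw [measureReal_def, gaussianReal_apply_eq_integral 0 one_ne_zero, ENNReal.toReal_ofReal
    (integral_nonneg fun x => gaussianPDFReal_nonneg _ _ _)]
  rfl

lemma stdCdf_eq_integral (x : ℝ) : stdCdf x = ∫ t in Set.Iic x, stdPdf t := by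
  rw [stdCdf, cdf_eq_real, measureReal_gaussianReal_zero_one]

lemma hasDerivAt_stdCdf (x : ℝ) : HasDerivAt stdCdf (stdPdf x) x := by
  have h : stdCdf = fun x => stdCdf 0 + ∫ t in (0 : ℝ)..x, stdPdf t := by
    ext x
    rw [← intervalIntegral.integral_Iic_sub_Iic integrable_stdPdf.integrableOn
      integrable_stdPdf.integrableOn, ← stdCdf_eq_integral, ← stdCdf_eq_integral]
    ring
  rw [h]
  exact (intervalIntegral.integral_hasDerivAt_right integrable_stdPdf.intervalIntegrable
    (continuous_stdPdf.stronglyMeasurableAtFilter _ _) continuous_stdPdf.continuousAt).const_add _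

lemma stdCdf_nonneg (x : ℝ) : 0 ≤ stdCdf x := cdf_nonneg _ _

lemma stdCdf_le_one (x : ℝ) : stdCdf x ≤ 1 := cdf_le_one _ _

lemma stdCdf_neg (x : ℝ) : stdCdf (-x) = (gaussianReal 0 1).real (Set.Ioi x) := by
  have : NullSingletonClass (gaussianReal 0 1) := nullSingletonClass_gaussianReal one_ne_zero
  have h_symm : (gaussianReal 0 1).map (fun x => -x) = gaussianReal 0 1 := by
    rw [gaussianReal_map_neg, neg_zero]
  rw [stdCdf, cdf_eq_real, ← h_symm, map_measureReal_apply measurable_neg measurableSet_Iic,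
    h_symm, Set.neg_preimage, Set.neg_Iic, neg_neg]
  exact measureReal_congr Ioi_ae_eq_Ici.symm

lemma stdCdf_add_stdCdf_neg (x : ℝ) : stdCdf x + stdCdf (-x) = 1 := by
  rw [stdCdf_neg, stdCdf, cdf_eq_real, ← Set.compl_Iic,
    probReal_compl_eq_one_sub measurableSet_Iic, add_sub_cancel]

lemma stdCdf_zero : stdCdf 0 = 1 / 2 := by
  have h := stdCdf_add_stdCdf_neg 0
  rw [neg_zero] at h
  linarith

/-- The mean `φ(w) + w Φ(w)` of the positive part of `w + Z`, where `Z ∼ N(0, 1)`; see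
`integral_max_add_gaussianReal`. -/
noncomputable def posMean (w : ℝ) : ℝ := stdPdf w + w * stdCdf w

lemma G_eq_posMean_sub (w β : ℝ) : G w β = posMean w - β * w := rfl

lemma posMean_sub_posMean_neg (w : ℝ) : posMean w - posMean (-w) = w := by
  rw [posMean, posMean, stdPdf_neg]
  linear_combination w * stdCdf_add_stdCdf_neg w

lemma integral_Ioi_mul_stdPdf (a : ℝ) : ∫ x in Set.Ioi a, x * stdPdf x = stdPdf a := by
  have h_deriv (x : ℝ) : HasDerivAt (fun x => -stdPdf x) (x * stdPdf x) x := by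
    simpa using (hasDerivAt_stdPdf x).fun_neg
  have h_lim : Tendsto (fun x => -stdPdf x) atTop (𝓝 (-0)) := by
    refine (squeeze_zero' (Eventually.of_forall stdPdf_nonneg) ?_
      Real.tendsto_exp_neg_atTop_nhds_zero).neg
    filter_upwards [eventually_ge_atTop 2] with x hx
    refine (stdPdf_le_exp x).trans (Real.exp_le_exp.2 ?_)
    nlinarith
  rw [integral_Ioi_of_hasDerivAt_of_tendsto (h_deriv a).continuousAt.continuousWithinAt
    (fun x _ => h_deriv x) integrable_mul_stdPdf.integrableOn h_lim]
  ring

lemma integral_max_add_gaussianReal (w : ℝ) :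
    ∫ z, max (w + z) 0 ∂(gaussianReal 0 1) = posMean w := by
  have h_indicator : (fun z => stdPdf z * max (w + z) 0) =
      (Set.Ioi (-w)).indicator fun z => w * stdPdf z + z * stdPdf z := by
    ext z
    rcases lt_or_ge (-w) z with hz | hz
    · rw [Set.indicator_of_mem (Set.mem_Ioi.2 hz), max_eq_left (by linarith)]
      ring
    · rw [Set.indicator_of_notMem (by simpa using hz), max_eq_right (by linarith), mul_zero]
  rw [integral_gaussianReal_zero_one, h_indicator, integral_indicator measurableSet_Ioi,
    integral_add (integrable_stdPdf.const_mul w).integrableOn integrable_mul_stdPdf.integrableOn,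
    integral_Ioi_mul_stdPdf, integral_const_mul, ← measureReal_gaussianReal_zero_one,
    ← stdCdf_neg, neg_neg, stdPdf_neg, posMean, add_comm]

lemma posMean_nonneg (w : ℝ) : 0 ≤ posMean w := by
  rw [← integral_max_add_gaussianReal]
  exact integral_nonneg fun z => le_max_right _ _

lemma posMean_le_one_add_abs (w : ℝ) : posMean w ≤ 1 + |w| := by
  have h_pdf : stdPdf w ≤ 1 :=
    (stdPdf_le_exp w).trans (Real.exp_le_one_iff.2 (by nlinarith [sq_nonneg w]))
  have h_cdf : w * stdCdf w ≤ |w| := by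
    nlinarith [le_abs_self w, neg_le_abs w, stdCdf_nonneg w, stdCdf_le_one w]
  exact add_le_add h_pdf h_cdf

lemma posMean_neg_le_exp {w : ℝ} (hw : 0 ≤ w) : posMean (-w) ≤ Real.exp (-(w ^ 2 / 2)) := by
  refine le_trans ?_ (stdPdf_le_exp w)
  rw [posMean, stdPdf_neg]
  nlinarith [stdCdf_nonneg (-w)]

lemma posMean_sq_le_exp (w : ℝ) : posMean w ^ 2 ≤ 4 * Real.exp (w ^ 2 / 2) :=
  calc posMean w ^ 2 ≤ (1 + |w|) ^ 2 := by
        gcongr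
        exacts [posMean_nonneg w, posMean_le_one_add_abs w]
    _ ≤ 4 * (w ^ 2 / 2 + 1) := by nlinarith [sq_abs w, sq_nonneg (|w| - 1)]
    _ ≤ 4 * Real.exp (w ^ 2 / 2) := by gcongr; exact Real.add_one_le_exp _

lemma G_eq_convex_combination (w β : ℝ) :
    G w β = (1 - β) * posMean w + β * posMean (-w) := by
  rw [G_eq_posMean_sub]
  linear_combination β * posMean_sub_posMean_neg w

lemma abs_G_le {β : ℝ} (hβ : β ∈ Set.Icc 0 1) (w : ℝ) : |G w β| ≤ 1 + |w| := by
  have h_pos := posMean_le_one_add_abs w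
  have h_neg := posMean_le_one_add_abs (-w)
  rw [abs_neg] at h_neg
  have hβ' : 0 ≤ 1 - β := sub_nonneg.2 hβ.2
  rw [G_eq_convex_combination, abs_of_nonneg (add_nonneg (mul_nonneg hβ' (posMean_nonneg w))
    (mul_nonneg hβ.1 (posMean_nonneg (-w))))]
  nlinarith [hβ.1]

lemma hasDerivAt_G (w β : ℝ) : HasDerivAt (fun w => G w β) (stdCdf w - β) w := by
  convert! ((hasDerivAt_stdPdf w).add ((hasDerivAt_id w).mul (hasDerivAt_stdCdf w))).sub
    ((hasDerivAt_id w).const_mul β) using 1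
  simp

lemma integrable_id_gaussianReal (w : ℝ) (v : ℝ≥0) :
    Integrable (fun u : ℝ => u) (gaussianReal w v) := by
  simpa only [Polynomial.eval_X] using integrable_eval_gaussianReal Polynomial.X w v

lemma integral_max_zero_gaussianReal (m : ℝ) {s : ℝ≥0} (hs : s ≠ 0) :
    ∫ t, max t 0 ∂(gaussianReal m s) = √(s : ℝ) * posMean (m / √(s : ℝ)) := by
  have h_pos : 0 < √(s : ℝ) := Real.sqrt_pos.2 (by positivity)
  rw [integral_gaussianReal_eq_standard m s (by fun_prop), ← integral_max_add_gaussianReal,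
    ← integral_const_mul]
  congr with z
  rw [mul_max_of_nonneg _ _ h_pos.le, mul_zero, mul_add, mul_div_cancel₀ _ h_pos.ne']

/-- The loss of an estimation error `t`: slope `b` for underestimation and `h` for
overestimation. -/
noncomputable def checkLoss (b h t : ℝ) : ℝ := b * max (-t) 0 + h * max t 0

lemma continuous_checkLoss (b h : ℝ) : Continuous (checkLoss b h) := by
  unfold checkLoss
  fun_prop

lemma integrable_checkLoss_gaussianReal (b h m : ℝ) (s : ℝ≥0) :
    Integrable (checkLoss b h) (gaussianReal m s) :=
  ((integrable_id_gaussianReal m s).neg.pos_part.const_mul b).add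
    ((integrable_id_gaussianReal m s).pos_part.const_mul h)

lemma integral_checkLoss_gaussianReal {b h : ℝ} (hbh : b + h ≠ 0) (m : ℝ) {s : ℝ≥0}
    (hs : s ≠ 0) :
    ∫ t, checkLoss b h t ∂(gaussianReal m s) =
      (b + h) * √(s : ℝ) * G (m / √(s : ℝ)) (b / (b + h)) := by
  have : 0 < √(s : ℝ) := Real.sqrt_pos.2 (by positivity)
  have h_eq (t : ℝ) : checkLoss b h t = (b + h) * max t 0 - b * t := by
    unfold checkLoss
    rcases le_total t 0 with ht | ht
    · rw [max_eq_left (by linarith), max_eq_right ht]; ring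
    · rw [max_eq_right (by linarith), max_eq_left ht]; ring
  have h_id := integrable_id_gaussianReal m s
  simp only [h_eq]
  rw [integral_sub (h_id.pos_part.const_mul _) (h_id.const_mul _), integral_const_mul,
    integral_const_mul, integral_id_gaussianReal, integral_max_zero_gaussianReal m hs,
    G_eq_posMean_sub]
  field_simp

/-! ### Taylor expansion of `G` -/

lemma abs_exp_sub_sum_le {x : ℝ} (hx : x ≤ 0) (J : ℕ) :
    |Real.exp x - ∑ j ∈ Finset.range J, x ^ j / (j.factorial : ℝ)| ≤
      |x| ^ J / (J.factorial : ℝ) := by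
  rcases hx.eq_or_lt with rfl | hx
  · cases J <;> simp [Finset.sum_range_succ']
  cases J with
  | zero => simpa using hx.le
  | succ J =>
    obtain ⟨y, hy, h_lagrange⟩ := taylor_mean_remainder_lagrange_iteratedDeriv (n := J) hx.ne'
      Real.contDiff_exp.contDiffOn
    have h_taylor : taylorWithinEval Real.exp J (Set.uIcc 0 x) 0 x =
        ∑ j ∈ Finset.range (J + 1), x ^ j / (j.factorial : ℝ) := by
      rw [taylor_within_apply]
      refine Finset.sum_congr rfl fun j _ => ?_
      rw [iteratedDerivWithin_eq_iteratedDeriv (uniqueDiffOn_uIcc hx.ne')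
        Real.contDiff_exp.contDiffAt Set.left_mem_uIcc, iteratedDeriv_eq_iterate,
        Real.iter_deriv_exp, Real.exp_zero, sub_zero, smul_eq_mul, mul_one, inv_mul_eq_div]
    have h_exp : Real.exp y ≤ 1 := by
      rw [Set.uIoo_of_gt hx] at hy
      exact Real.exp_le_one_iff.2 hy.2.le
    rw [← h_taylor, h_lagrange, iteratedDeriv_eq_iterate, Real.iter_deriv_exp, sub_zero, abs_div,
      abs_mul, abs_pow, Real.abs_exp, Nat.abs_cast]
    gcongr
    exact mul_le_of_le_one_left (by positivity) h_exp

lemma herm_add_two_apply_zero (k : ℕ) : herm (k + 2) 0 = -((k + 1) * herm k 0) := by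
  simp [herm_eq_eval, hermitePoly_succ (k + 1), derivative_hermitePoly]

lemma herm_apply_zero_sq_le (k : ℕ) : herm k 0 ^ 2 ≤ k.factorial := by
  induction k using Nat.twoStepInduction with
  | zero => simp [herm_zero]
  | one => simp [herm_one]
  | more k ih _ =>
    calc herm (k + 2) 0 ^ 2 = ((k : ℝ) + 1) ^ 2 * herm k 0 ^ 2 := by
          rw [herm_add_two_apply_zero]; ring
      _ ≤ ((k : ℝ) + 2) * (k + 1) * k.factorial := by gcongr; nlinarith
      _ = (k + 2).factorial := by
          rw [Nat.factorial_succ, Nat.factorial_succ]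
          push_cast
          ring

lemma herm_two_mul_add_one_apply_zero (j : ℕ) : herm (2 * j + 1) 0 = 0 := by
  induction j with
  | zero => simp [herm_one]
  | succ j ih =>
    rw [show 2 * (j + 1) + 1 = 2 * j + 1 + 2 by ring, herm_add_two_apply_zero, ih, mul_zero,
      neg_zero]

lemma herm_two_mul_apply_zero_div (j : ℕ) :
    herm (2 * j) 0 / ((2 * j).factorial : ℝ) = (-1 / 2) ^ j / (j.factorial : ℝ) := by
  induction j with
  | zero => simp [herm_zero]
  | succ j ih =>
    rw [eq_div_iff (by positivity), div_mul_eq_mul_div, div_eq_iff (by positivity)] at ih ⊢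
    rw [show 2 * (j + 1) = 2 * j + 2 by ring, herm_add_two_apply_zero]
    simp only [Nat.factorial_succ]
    push_cast
    linear_combination -(2 * j + 1) * (j + 1) * ih

lemma sum_herm_apply_zero_mul_pow (N : ℕ) (t : ℝ) :
    ∑ k ∈ Finset.range N, (-1) ^ k * herm k 0 / (k.factorial : ℝ) * t ^ k =
      ∑ j ∈ Finset.range ((N + 1) / 2), (-(t ^ 2 / 2)) ^ j / (j.factorial : ℝ) := by
  induction N with
  | zero => simp
  | succ N ih =>
    rw [Finset.sum_range_succ, ih]
    rcases Nat.even_or_odd' N with ⟨j, rfl | rfl⟩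
    · rw [show (2 * j + 1 + 1) / 2 = (2 * j + 1) / 2 + 1 by omega, Finset.sum_range_succ,
        show (2 * j + 1) / 2 = j by omega, mul_div_assoc, herm_two_mul_apply_zero_div,
        (even_two_mul j).neg_one_pow, one_mul, pow_mul, div_mul_eq_mul_div, ← mul_pow]
      ring_nf
    · rw [herm_two_mul_add_one_apply_zero, show (2 * j + 1 + 1 + 1) / 2 = (2 * j + 1 + 1) / 2 by
        omega, mul_zero, zero_div, zero_mul, add_zero]

/-- The Taylor coefficients of `w ↦ G w β` at `0`; from the second on they do not depend on `β`,
since the second derivative of `G` is the normal density. -/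
noncomputable def taylorCoeff (β : ℝ) : ℕ → ℝ
  | 0 => G 0 β
  | 1 => stdCdf 0 - β
  | k + 2 => stdPdf 0 * ((-1) ^ k * herm k 0 / ((k + 2).factorial : ℝ))

/-- The Taylor polynomial of `w ↦ G w β` at `0` with `N` terms. -/
noncomputable def taylorG (β : ℝ) (N : ℕ) (w : ℝ) : ℝ :=
  ∑ k ∈ Finset.range N, taylorCoeff β k * w ^ k

lemma hasDerivAt_sum_mul_pow (a : ℕ → ℝ) (N : ℕ) (x : ℝ) :
    HasDerivAt (fun x => ∑ k ∈ Finset.range (N + 1), a k * x ^ k)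
      (∑ k ∈ Finset.range N, (k + 1) * a (k + 1) * x ^ k) x := by
  simp only [Finset.sum_range_succ' _ N, pow_zero, mul_one]
  refine (HasDerivAt.fun_sum fun k _ => ?_).add_const _
  convert! (hasDerivAt_pow (k + 1) x).const_mul (a (k + 1)) using 1
  push_cast [Nat.add_sub_cancel]
  ring

lemma abs_le_mul_abs_of_hasDerivAt {f f' : ℝ → ℝ} {B w : ℝ} (h0 : f 0 = 0)
    (hf : ∀ t, HasDerivAt f (f' t) t) (hB : ∀ t, |t| ≤ |w| → |f' t| ≤ B) : |f w| ≤ B * |w| := by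
  simpa [h0] using (convex_Icc (-|w|) |w|).norm_image_sub_le_of_norm_hasDerivWithin_le
    (fun x _ => (hf x).hasDerivWithinAt) (fun t ht => hB t (abs_le.2 ht))
    (by simp : (0 : ℝ) ∈ Set.Icc (-|w|) |w|) (abs_le.1 le_rfl)

lemma abs_le_mul_sq_of_hasDerivAt {f f' f'' : ℝ → ℝ} {B w : ℝ} (h0 : f 0 = 0) (h0' : f' 0 = 0)
    (hf : ∀ t, HasDerivAt f (f' t) t) (hf' : ∀ t, HasDerivAt f' (f'' t) t)
    (hB : ∀ t, |t| ≤ |w| → |f'' t| ≤ B) : |f w| ≤ B * w ^ 2 := by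
  have hB0 : 0 ≤ B := (abs_nonneg _).trans (hB 0 (by simp))
  have h := abs_le_mul_abs_of_hasDerivAt h0 hf (B := B * |w|) fun t ht =>
    (abs_le_mul_abs_of_hasDerivAt h0' hf' fun r hr => hB r (hr.trans ht)).trans (by gcongr)
  rwa [mul_assoc, ← sq, sq_abs] at h

lemma abs_stdPdf_sub_sum_le (N : ℕ) (t : ℝ) :
    |stdPdf t - stdPdf 0 * ∑ k ∈ Finset.range N, (-1) ^ k * herm k 0 / (k.factorial : ℝ) * t ^ k| ≤
      (t ^ 2 / 2) ^ ((N + 1) / 2) / (((N + 1) / 2).factorial : ℝ) := by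
  have h_exp := abs_exp_sub_sum_le (neg_nonpos.2 (by positivity : 0 ≤ t ^ 2 / 2)) ((N + 1) / 2)
  rw [abs_neg, abs_of_nonneg (by positivity : 0 ≤ t ^ 2 / 2)] at h_exp
  rw [sum_herm_apply_zero_mul_pow, stdPdf_eq, ← mul_sub, abs_mul, abs_of_nonneg (stdPdf_nonneg 0)]
  exact (mul_le_of_le_one_left (abs_nonneg _) stdPdf_zero_le_one).trans h_exp

-- The second derivative of the difference is the error of the exponential series for `φ`.
lemma abs_G_sub_taylorG_le (β : ℝ) (N : ℕ) (w : ℝ) :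
    |G w β - taylorG β (N + 2) w| ≤
      (w ^ 2 / 2) ^ ((N + 1) / 2) / (((N + 1) / 2).factorial : ℝ) * w ^ 2 := by
  refine abs_le_mul_sq_of_hasDerivAt (f := fun t => G t β - taylorG β (N + 2) t)
    (by simp [taylorG, Finset.sum_range_succ', taylorCoeff])
    (by simp [Finset.sum_range_succ', taylorCoeff])
    (fun t => (hasDerivAt_G t β).sub (hasDerivAt_sum_mul_pow (taylorCoeff β) (N + 1) t))
    (fun t => ((hasDerivAt_stdCdf t).sub_const β).sub (hasDerivAt_sum_mul_pow _ N t))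
    fun t ht => ?_
  have h_sum : ∑ k ∈ Finset.range N,
        ((k : ℝ) + 1) * (((k + 1 : ℕ) : ℝ) + 1) * taylorCoeff β (k + 1 + 1) * t ^ k =
      stdPdf 0 * ∑ k ∈ Finset.range N, (-1) ^ k * herm k 0 / (k.factorial : ℝ) * t ^ k := by
    rw [Finset.mul_sum]
    refine Finset.sum_congr rfl fun k _ => ?_
    rw [taylorCoeff, Nat.factorial_succ, Nat.factorial_succ]
    push_cast
    field_simp
  simp only [← mul_assoc]
  rw [h_sum]
  refine (abs_stdPdf_sub_sum_le N t).trans ?_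
  gcongr ?_ ^ _ / _
  linarith [sq_le_sq.2 ht]

/-! ### The Hermite estimate -/

/-- The unbiased estimate of the Taylor polynomial `taylorG β N w` from one observation of
`N(w, s)` (`integral_hermEst`): each power `w ^ k` is replaced by the scaled Hermite polynomial. -/
noncomputable def hermEst (β s : ℝ) (N : ℕ) (u : ℝ) : ℝ :=
  ∑ k ∈ Finset.range N, taylorCoeff β k * scaledHerm k s u

lemma continuous_hermEst (β s : ℝ) (N : ℕ) : Continuous (hermEst β s N) :=
  continuous_finsetSum _ fun k _ => (continuous_scaledHerm k s).const_mul _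

lemma memLp_hermEst (β s : ℝ) (N : ℕ) (w : ℝ) (v : ℝ≥0) :
    MemLp (hermEst β s N) 2 (gaussianReal w v) :=
  memLp_finsetSum _ fun k _ => (memLp_scaledHerm k s w v).const_mul _

lemma integral_hermEst (β : ℝ) (s : ℝ≥0) (N : ℕ) (w : ℝ) :
    ∫ u, hermEst β s N u ∂(gaussianReal w s) = taylorG β N w := by
  simp only [hermEst, taylorG]
  rw [integral_finsetSum _ fun k _ =>
    ((memLp_scaledHerm k s w s).integrable one_le_two).const_mul _]
  simp only [integral_const_mul, integral_scaledHerm]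

lemma taylorCoeff_sq_mul_factorial_le_one {β : ℝ} (hβ : β ∈ Set.Icc 0 1) (k : ℕ) :
    taylorCoeff β k ^ 2 * ((k + 1) * k.factorial) ≤ 1 := by
  match k with
  | 0 =>
    have h : taylorCoeff β 0 = stdPdf 0 := by simp [taylorCoeff, G]
    rw [h, Nat.factorial_zero, Nat.cast_zero, Nat.cast_one]
    linarith [stdPdf_zero_sq_le]
  | 1 =>
    rw [taylorCoeff, stdCdf_zero]
    norm_num
    nlinarith [hβ.1, hβ.2]
  | k + 2 =>
    have h_herm := herm_apply_zero_sq_le k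
    have h_fact : ((k + 2).factorial : ℝ) = (k + 2) * ((k + 1) * k.factorial) := by
      rw [Nat.factorial_succ, Nat.factorial_succ]
      push_cast
      ring
    calc taylorCoeff β (k + 2) ^ 2 * (((k + 2 : ℕ) + 1) * (k + 2).factorial)
        = stdPdf 0 ^ 2 * (herm k 0 ^ 2 * (((k : ℝ) + 3) / (k + 2).factorial)) := by
          rw [taylorCoeff, mul_pow, div_pow, mul_pow, ← pow_mul, mul_comm k 2,
            (even_two_mul k).neg_one_pow]
          push_cast
          field_simp
          ring
      _ ≤ 1 / 6 * (k.factorial * (((k : ℝ) + 3) / (k + 2).factorial)) := by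
          gcongr
          exact stdPdf_zero_sq_le
      _ = ((k : ℝ) + 3) / (6 * ((k + 2) * (k + 1))) := by
          rw [h_fact]
          field_simp
      _ ≤ 1 := by
          rw [div_le_one (by positivity)]
          nlinarith [(Nat.cast_nonneg k : (0 : ℝ) ≤ k)]

lemma integral_hermEst_sq_le {β : ℝ} (hβ : β ∈ Set.Icc 0 1) {s : ℝ≥0} (hs : s < 1) (N : ℕ)
    (w : ℝ) :
    ∫ u, hermEst β s N u ^ 2 ∂(gaussianReal w s) ≤ N ^ 2 * Real.exp (w ^ 2 / (1 - s)) := by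
  set E := Real.exp (w ^ 2 / (1 - s))
  have h_term (k : ℕ) :
      ∫ u, (taylorCoeff β k * scaledHerm k s u) ^ 2 ∂(gaussianReal w s) ≤ E := by
    simp only [mul_pow, integral_const_mul]
    calc _ ≤ taylorCoeff β k ^ 2 * ((k + 1) * k.factorial * E) :=
          mul_le_mul_of_nonneg_left (integral_scaledHerm_sq_le k w hs) (sq_nonneg _)
      _ = taylorCoeff β k ^ 2 * ((k + 1) * k.factorial) * E := by ring
      _ ≤ E := mul_le_of_le_one_left (Real.exp_pos _).le
          (taylorCoeff_sq_mul_factorial_le_one hβ k)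
  calc _ ≤ (Finset.range N).card * ∑ k ∈ Finset.range N,
        ∫ u, (taylorCoeff β k * scaledHerm k s u) ^ 2 ∂(gaussianReal w s) :=
        integral_sum_sq_le _ fun k _ => (memLp_scaledHerm k s w s).const_mul _
    _ ≤ N * ∑ _ ∈ Finset.range N, E := by
        rw [Finset.card_range]
        gcongr with k
        exact h_term k
    _ = N ^ 2 * E := by
        rw [Finset.sum_const, Finset.card_range, nsmul_eq_mul]
        ring

/-! ### Rotation of an independent Gaussian pair -/

lemma charFunDual_gaussianReal (m : ℝ) (v : ℝ≥0) (L : StrongDual ℝ ℝ) :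
    charFunDual (gaussianReal m v) L = Complex.exp (L 1 * m * Complex.I - v * L 1 ^ 2 / 2) := by
  rw [← charFun_gaussianReal, charFunDual_apply, charFun_apply_real]
  congr with x
  have h_linear : L x = L 1 * x := by simpa [mul_comm] using L.map_smul x 1
  rw [h_linear]
  push_cast
  rfl

lemma map_add_sub_prod_gaussianReal (m₁ m₂ : ℝ) (v : ℝ≥0) :
    ((gaussianReal m₁ v).prod (gaussianReal m₂ v)).map (fun p => (p.1 + p.2, p.1 - p.2)) =
      (gaussianReal (m₁ + m₂) (2 * v)).prod (gaussianReal (m₁ - m₂) (2 * v)) := by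
  let A : ℝ × ℝ →L[ℝ] ℝ × ℝ :=
    (ContinuousLinearMap.fst ℝ ℝ ℝ + ContinuousLinearMap.snd ℝ ℝ ℝ).prod
      (ContinuousLinearMap.fst ℝ ℝ ℝ - ContinuousLinearMap.snd ℝ ℝ ℝ)
  change Measure.map A _ = _
  refine Measure.ext_of_charFunDual (funext fun L => ?_)
  have h_fst : L (1, 1) = L (1, 0) + L (0, 1) := by rw [← map_add]; simp
  have h_snd : L (1, -1) = L (1, 0) - L (0, 1) := by rw [← map_sub]; simp
  rw [charFunDual_map, charFunDual_prod, charFunDual_prod]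
  simp only [charFunDual_gaussianReal, ← Complex.exp_add]
  simp only [A, ContinuousLinearMap.comp_apply, ContinuousLinearMap.inl_apply,
    ContinuousLinearMap.inr_apply, ContinuousLinearMap.prod_apply, add_apply, sub_apply,
    ContinuousLinearMap.coe_fst', ContinuousLinearMap.coe_snd',
    add_zero, zero_add, sub_zero, zero_sub, h_fst, h_snd]
  push_cast
  ring_nf

lemma map_affine_add_sub_prod_gaussianReal (θ c d : ℝ) (v s : ℝ≥0) (hs : (s : ℝ) = 2 * v * d ^ 2) :
    ((gaussianReal θ v).prod (gaussianReal 0 1)).map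
        (fun p => (c + d * (p.1 + √(v : ℝ) * p.2), c + d * (p.1 - √(v : ℝ) * p.2))) =
      (gaussianReal (c + d * θ) s).prod (gaussianReal (c + d * θ) s) := by
  have h_scale : ((gaussianReal θ v).prod (gaussianReal 0 1)).map
      (Prod.map id fun z => 0 + √(v : ℝ) * z) = (gaussianReal θ v).prod (gaussianReal 0 v) := by
    rw [← Measure.map_prod_map _ _ measurable_id (by fun_prop), Measure.map_id,
      map_add_sqrt_mul_gaussianReal]
  have h_affine (m : ℝ) : (gaussianReal m (2 * v)).map (fun x => c + d * x) =
      gaussianReal (c + d * m) s := by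
    rw [map_add_mul_gaussianReal]
    congr 1
    ext
    push_cast
    rw [hs]
    ring
  rw [show (fun p : ℝ × ℝ => (c + d * (p.1 + √(v : ℝ) * p.2), c + d * (p.1 - √(v : ℝ) * p.2))) =
      Prod.map (fun x => c + d * x) (fun x => c + d * x) ∘ (fun p => (p.1 + p.2, p.1 - p.2)) ∘
        Prod.map id fun z => 0 + √(v : ℝ) * z by ext p <;> simp,
    ← Measure.map_map (by fun_prop) (by fun_prop), ← Measure.map_map (by fun_prop) (by fun_prop),
    h_scale, map_add_sub_prod_gaussianReal, ← Measure.map_prod_map _ _ (by fun_prop) (by fun_prop),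
    h_affine, h_affine, add_zero, sub_zero]

/-! ### Thresholding and Rao-Blackwellization -/

section Threshold

/-- A function of the first variable, chosen among three according to the position of the second
variable relative to `[-l, l]`. -/
noncomputable def threshold (l : ℝ) (f g h : ℝ → ℝ) (p : ℝ × ℝ) : ℝ :=
  if p.2 < -l then f p.1 else if p.2 ≤ l then g p.1 else h p.1

lemma threshold_eq_add_indicator {l : ℝ} (hl : 0 ≤ l) (f g h : ℝ → ℝ) (p : ℝ × ℝ) :
    threshold l f g h p = f p.1 * (Set.Iio (-l)).indicator 1 p.2 +
      g p.1 * (Set.Icc (-l) l).indicator 1 p.2 + h p.1 * (Set.Ioi l).indicator 1 p.2 := by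
  rcases lt_or_ge p.2 (-l) with h_lt | h_ge
  · have h_le : p.2 ≤ l := by linarith
    simp [threshold, h_lt, h_lt.not_ge, h_le]
  · rcases le_or_gt p.2 l with h_le | h_gt
    · simp [threshold, h_ge, h_ge.not_gt, h_le, h_le.not_gt]
    · simp [threshold, h_ge.not_gt, h_gt, h_gt.not_ge]

lemma threshold_sub (l : ℝ) (f g h : ℝ → ℝ) (a : ℝ) (p : ℝ × ℝ) :
    threshold l f g h p - a = threshold l (f · - a) (g · - a) (h · - a) p := by
  unfold threshold
  split_ifs <;> rfl

lemma threshold_sq (l : ℝ) (f g h : ℝ → ℝ) (p : ℝ × ℝ) :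
    threshold l f g h p ^ 2 = threshold l (f · ^ 2) (g · ^ 2) (h · ^ 2) p := by
  unfold threshold
  split_ifs <;> rfl

variable {μ ν : Measure ℝ} [IsProbabilityMeasure ν] {l : ℝ} {f g h : ℝ → ℝ}

lemma integrable_mul_indicator_prod [SFinite μ] (hf : Integrable f μ) {A : Set ℝ}
    (hA : MeasurableSet A) : Integrable (fun p => f p.1 * A.indicator 1 p.2) (μ.prod ν) :=
  hf.mul_prod ((integrable_const 1).indicator hA)

lemma integrable_threshold [SFinite μ] (hl : 0 ≤ l) (hf : Integrable f μ) (hg : Integrable g μ)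
    (hh : Integrable h μ) : Integrable (threshold l f g h) (μ.prod ν) := by
  rw [funext (threshold_eq_add_indicator hl f g h)]
  exact ((integrable_mul_indicator_prod hf measurableSet_Iio).add
    (integrable_mul_indicator_prod hg measurableSet_Icc)).add
    (integrable_mul_indicator_prod hh measurableSet_Ioi)

lemma integral_threshold [SFinite μ] (hl : 0 ≤ l) (hf : Integrable f μ) (hg : Integrable g μ)
    (hh : Integrable h μ) :
    ∫ p, threshold l f g h p ∂(μ.prod ν) = ν.real (Set.Iio (-l)) * ∫ u, f u ∂μ +
      ν.real (Set.Icc (-l) l) * ∫ u, g u ∂μ + ν.real (Set.Ioi l) * ∫ u, h u ∂μ := by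
  have hf' := integrable_mul_indicator_prod (ν := ν) hf (measurableSet_Iio (a := -l))
  have hg' := integrable_mul_indicator_prod (ν := ν) hg (measurableSet_Icc (a := -l) (b := l))
  have hh' := integrable_mul_indicator_prod (ν := ν) hh (measurableSet_Ioi (a := l))
  have hfg : Integrable (fun p : ℝ × ℝ => f p.1 * (Set.Iio (-l)).indicator 1 p.2 +
      g p.1 * (Set.Icc (-l) l).indicator 1 p.2) (μ.prod ν) := hf'.add hg'
  simp only [threshold_eq_add_indicator hl f g h]
  rw [integral_add hfg hh', integral_add hf' hg', integral_prod_mul, integral_prod_mul,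
    integral_prod_mul, integral_indicator_one measurableSet_Iio,
    integral_indicator_one measurableSet_Icc, integral_indicator_one measurableSet_Ioi]
  ring

lemma memLp_threshold [IsFiniteMeasure μ] (hl : 0 ≤ l) (hf : MemLp f 2 μ) (hg : MemLp g 2 μ)
    (hh : MemLp h 2 μ) : MemLp (threshold l f g h) 2 (μ.prod ν) := by
  have h_int : Integrable (threshold l f g h) (μ.prod ν) := integrable_threshold hl
    (hf.integrable one_le_two) (hg.integrable one_le_two) (hh.integrable one_le_two)
  rw [memLp_two_iff_integrable_sq h_int.aestronglyMeasurable]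
  simp only [threshold_sq]
  exact integrable_threshold hl hf.integrable_sq hg.integrable_sq hh.integrable_sq

end Threshold

section RaoBlackwell

variable {α β : Type*} {mα : MeasurableSpace α} {mβ : MeasurableSpace β} {P : Measure α}

lemma sq_integral_le_integral_sq [IsProbabilityMeasure P] {f : α → ℝ} (hf : MemLp f 2 P) :
    (∫ x, f x ∂P) ^ 2 ≤ ∫ x, f x ^ 2 ∂P := by
  have h_var := variance_eq_sub hf
  have h_nonneg := variance_nonneg f P
  simp only [Pi.pow_apply] at h_var
  linarith

variable {ν : Measure β} [SFinite P] [IsProbabilityMeasure ν] {F : α × β → ℝ}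

lemma sq_integral_prodMk_le_ae (hF : MemLp F 2 (P.prod ν)) :
    ∀ᵐ x ∂P, (∫ z, F (x, z) ∂ν) ^ 2 ≤ ∫ z, F (x, z) ^ 2 ∂ν := by
  filter_upwards [hF.aestronglyMeasurable.prodMk_left, hF.integrable_sq.prod_right_ae]
    with x h_meas h_sq
  exact sq_integral_le_integral_sq ((memLp_two_iff_integrable_sq h_meas).2 h_sq)

lemma memLp_integral_prodMk (hF : MemLp F 2 (P.prod ν)) :
    MemLp (fun x => ∫ z, F (x, z) ∂ν) 2 P := by
  have h_meas := hF.aestronglyMeasurable.integral_prod_right'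
  rw [memLp_two_iff_integrable_sq h_meas]
  refine hF.integrable_sq.integral_prod_left.mono' (h_meas.pow 2) ?_
  filter_upwards [sq_integral_prodMk_le_ae hF] with x hx
  rwa [Real.norm_of_nonneg (sq_nonneg _)]

lemma integral_sq_integral_prodMk_le (hF : MemLp F 2 (P.prod ν)) :
    ∫ x, (∫ z, F (x, z) ∂ν) ^ 2 ∂P ≤ ∫ p, F p ^ 2 ∂(P.prod ν) := by
  rw [integral_prod _ hF.integrable_sq]
  exact integral_mono_ae (memLp_integral_prodMk hF).integrable_sq
    hF.integrable_sq.integral_prod_left (sq_integral_prodMk_le_ae hF)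

lemma integral_integral_prodMk_sub [IsProbabilityMeasure P] (hF : Integrable F (P.prod ν)) (a : ℝ) :
    ∫ x, (∫ z, F (x, z) ∂ν - a) ∂P = ∫ p, (F p - a) ∂(P.prod ν) := by
  rw [integral_sub hF.integral_prod_left (integrable_const _),
    integral_sub hF (integrable_const _), integral_prod _ hF]
  simp

lemma integral_integral_prodMk_sub_sq_le [IsFiniteMeasure P] (hF : MemLp F 2 (P.prod ν)) (a : ℝ) :
    ∫ x, (∫ z, F (x, z) ∂ν - a) ^ 2 ∂P ≤ ∫ p, (F p - a) ^ 2 ∂(P.prod ν) := by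
  refine (integral_congr_ae ?_).trans_le
    (integral_sq_integral_prodMk_le (F := fun p => F p - a) (hF.sub (memLp_const a)))
  filter_upwards [(hF.integrable one_le_two).prod_right_ae] with x h_int
  rw [integral_sub h_int (integrable_const _), integral_const, probReal_univ, one_smul]

end RaoBlackwell

section ThresholdRule

variable {α β : Type*} {mα : MeasurableSpace α} {mβ : MeasurableSpace β} {P : Measure α}
  {ν : Measure β} {μ μ' : Measure ℝ} [IsProbabilityMeasure P] [IsProbabilityMeasure ν]
  [IsProbabilityMeasure μ] [IsProbabilityMeasure μ'] {Φ : α × β → ℝ × ℝ} {l : ℝ} {f g h : ℝ → ℝ}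

lemma memLp_integral_threshold_comp (hΦ : MeasurePreserving Φ (P.prod ν) (μ.prod μ')) (hl : 0 ≤ l)
    (hf : MemLp f 2 μ) (hg : MemLp g 2 μ) (hh : MemLp h 2 μ) :
    MemLp (fun x => ∫ z, threshold l f g h (Φ (x, z)) ∂ν) 2 P :=
  memLp_integral_prodMk ((memLp_threshold hl hf hg hh).comp_measurePreserving hΦ)

lemma integral_integral_threshold_comp_sub (hΦ : MeasurePreserving Φ (P.prod ν) (μ.prod μ'))
    (hl : 0 ≤ l) (hf : MemLp f 2 μ) (hg : MemLp g 2 μ) (hh : MemLp h 2 μ) (a : ℝ) :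
    ∫ x, (∫ z, threshold l f g h (Φ (x, z)) ∂ν - a) ∂P =
      μ'.real (Set.Iio (-l)) * ∫ u, (f u - a) ∂μ + μ'.real (Set.Icc (-l) l) * ∫ u, (g u - a) ∂μ +
        μ'.real (Set.Ioi l) * ∫ u, (h u - a) ∂μ := by
  have h_int {k : ℝ → ℝ} (hk : MemLp k 2 μ) : Integrable (fun u => k u - a) μ :=
    (hk.integrable one_le_two).sub (integrable_const a)
  have h_comp : Integrable (fun p => threshold l f g h (Φ p)) (P.prod ν) :=
    ((memLp_threshold hl hf hg hh).comp_measurePreserving hΦ).integrable one_le_two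
  have h_sub := integrable_threshold (μ := μ) (ν := μ') hl (h_int hf) (h_int hg) (h_int hh)
  rw [integral_integral_prodMk_sub h_comp, ← integral_threshold hl (h_int hf) (h_int hg) (h_int hh)]
  simp only [threshold_sub]
  rw [← hΦ.map_eq] at h_sub ⊢
  exact (integral_map hΦ.aemeasurable h_sub.aestronglyMeasurable).symm

lemma integral_integral_threshold_comp_sub_sq_le
    (hΦ : MeasurePreserving Φ (P.prod ν) (μ.prod μ')) (hl : 0 ≤ l) (hf : MemLp f 2 μ)
    (hg : MemLp g 2 μ) (hh : MemLp h 2 μ) (a : ℝ) :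
    ∫ x, (∫ z, threshold l f g h (Φ (x, z)) ∂ν - a) ^ 2 ∂P ≤
      μ'.real (Set.Iio (-l)) * ∫ u, (f u - a) ^ 2 ∂μ +
        μ'.real (Set.Icc (-l) l) * ∫ u, (g u - a) ^ 2 ∂μ +
        μ'.real (Set.Ioi l) * ∫ u, (h u - a) ^ 2 ∂μ := by
  have h_int {k : ℝ → ℝ} (hk : MemLp k 2 μ) : Integrable (fun u => (k u - a) ^ 2) μ :=
    (hk.sub (memLp_const a)).integrable_sq
  have h_comp : MemLp (fun p => threshold l f g h (Φ p)) 2 (P.prod ν) :=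
    (memLp_threshold hl hf hg hh).comp_measurePreserving hΦ
  have h_sq := integrable_threshold (μ := μ) (ν := μ') hl (h_int hf) (h_int hg) (h_int hh)
  refine (integral_integral_prodMk_sub_sq_le h_comp a).trans_eq ?_
  rw [← integral_threshold hl (h_int hf) (h_int hg) (h_int hh)]
  simp only [threshold_sub, threshold_sq]
  rw [← hΦ.map_eq] at h_sq ⊢
  exact (integral_map hΦ.aemeasurable h_sq.aestronglyMeasurable).symm

end ThresholdRule

/-! ### Truncation -/

/-- Truncation to absolute value at most `n`, for `0 ≤ n`. -/
noncomputable def clip (n x : ℝ) : ℝ := max (-n) (min x n)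

lemma clip_neg {n : ℝ} (hn : 0 ≤ n) (x : ℝ) : clip n (-x) = -clip n x := by
  rw [clip, clip, max_min_distrib_left, max_eq_right (neg_le_self hn), max_neg_neg,
    ← min_neg_neg, neg_neg, min_comm n x, min_comm]

lemma clip_of_nonneg {n x : ℝ} (hn : 0 ≤ n) (hx : 0 ≤ x) : clip n x = min x n :=
  max_eq_right ((neg_nonpos.2 hn).trans (le_min hx hn))

lemma sign_mul_min_abs {n : ℝ} (hn : 0 ≤ n) (x : ℝ) : Real.sign x * min |x| n = clip n x := by
  rcases lt_trichotomy x 0 with hx | rfl | hx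
  · rw [Real.sign_of_neg hx, abs_of_neg hx, neg_one_mul,
      ← clip_of_nonneg hn (neg_nonneg.2 hx.le), clip_neg hn, neg_neg]
  · simp [clip, hn]
  · rw [Real.sign_of_pos hx, abs_of_pos hx, one_mul, clip_of_nonneg hn hx.le]

lemma continuous_clip (n : ℝ) : Continuous (clip n) := by
  unfold clip
  fun_prop

lemma abs_clip {n : ℝ} (hn : 0 ≤ n) (x : ℝ) : |clip n x| = min |x| n := by
  wlog hx : 0 ≤ x generalizing x
  · rw [← abs_neg, ← clip_neg hn, this _ (neg_nonneg.2 (not_le.1 hx).le), abs_neg]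
  rw [clip_of_nonneg hn hx, abs_of_nonneg (le_min hx hn), abs_of_nonneg hx]

lemma abs_clip_sub_le {n : ℝ} (hn : 0 < n) (x : ℝ) : |clip n x - x| ≤ x ^ 2 / n := by
  wlog hx : 0 ≤ x generalizing x
  · have h_neg := this (-x) (neg_nonneg.2 (not_le.1 hx).le)
    rwa [clip_neg hn.le, neg_sub_neg, abs_sub_comm, neg_sq] at h_neg
  rw [clip_of_nonneg hn.le hx, abs_sub_comm, abs_of_nonneg (sub_nonneg.2 (min_le_left _ _)),
    le_div_iff₀ hn]
  rcases le_total x n with h | h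
  · rw [min_eq_left h]
    nlinarith
  · rw [min_eq_right h]
    nlinarith

section Clip

variable {α : Type*} {mα : MeasurableSpace α} {P : Measure α} {f : α → ℝ} {n : ℝ}

lemma memLp_clip [IsFiniteMeasure P] (hn : 0 ≤ n) (hf : AEStronglyMeasurable f P) (p : ℝ≥0∞) :
    MemLp (fun x => clip n (f x)) p P :=
  (memLp_const n).of_le ((continuous_clip n).comp_aestronglyMeasurable hf)
    (ae_of_all _ fun x => by
      rw [Real.norm_eq_abs, abs_clip hn, Real.norm_of_nonneg hn]
      exact min_le_right _ _)

lemma sub_sq_le_two_mul_add (a b : ℝ) : (a - b) ^ 2 ≤ 2 * a ^ 2 + 2 * b ^ 2 := by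
  nlinarith [sq_nonneg (a + b)]

variable [IsProbabilityMeasure P]

lemma abs_integral_clip_sub_le (hn : 0 < n) (hf : MemLp f 2 P) (g : ℝ) :
    |∫ x, (clip n (f x) - g) ∂P| ≤ (∫ x, f x ^ 2 ∂P) / n + |∫ x, f x ∂P - g| := by
  have h_clip : Integrable (fun x => clip n (f x)) P :=
    (memLp_clip hn.le hf.aestronglyMeasurable 1).integrable le_rfl
  have h_int : Integrable f P := hf.integrable one_le_two
  have h_split : ∫ x, (clip n (f x) - g) ∂P =
      ∫ x, (clip n (f x) - f x) ∂P + (∫ x, f x ∂P - g) := by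
    rw [integral_sub h_clip (integrable_const _), integral_sub h_clip h_int]
    simp
  rw [h_split, ← integral_div]
  refine (abs_add_le _ _).trans (add_le_add_left ?_ _)
  exact norm_integral_le_of_norm_le (f := fun x => clip n (f x) - f x)
    (hf.integrable_sq.div_const n) (ae_of_all _ fun x => abs_clip_sub_le hn (f x))

lemma integral_clip_sub_sq_le (hn : 0 ≤ n) (hf : MemLp f 2 P) (g : ℝ) :
    ∫ x, (clip n (f x) - g) ^ 2 ∂P ≤ 2 * ∫ x, f x ^ 2 ∂P + 2 * g ^ 2 := by
  have h_sq : Integrable (fun x => 2 * f x ^ 2) P := hf.integrable_sq.const_mul 2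
  calc ∫ x, (clip n (f x) - g) ^ 2 ∂P ≤ ∫ x, (2 * f x ^ 2 + 2 * g ^ 2) ∂P := by
        refine integral_mono_of_nonneg (ae_of_all _ fun x => sq_nonneg _)
          (h_sq.add (integrable_const _)) (ae_of_all _ fun x => ?_)
        have h_clip : clip n (f x) ^ 2 ≤ f x ^ 2 := by
          rw [sq_le_sq, abs_clip hn]
          exact min_le_left _ _
        exact (sub_sq_le_two_mul_add _ _).trans
          (add_le_add_left (mul_le_mul_of_nonneg_left h_clip zero_le_two) _)
    _ = 2 * ∫ x, f x ^ 2 ∂P + 2 * g ^ 2 := by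
        rw [integral_add h_sq (integrable_const _), integral_const_mul]
        simp

lemma abs_integral_clip_sub_le_add (hn : 0 ≤ n) (f : α → ℝ) (g : ℝ) :
    |∫ x, (clip n (f x) - g) ∂P| ≤ n + |g| := by
  have h_bound := norm_integral_le_of_norm_le_const (μ := P) (C := n + |g|)
    (f := fun x => clip n (f x) - g) (ae_of_all _ fun x =>
      (abs_sub _ _).trans (add_le_add_left ((abs_clip hn _).trans_le (min_le_right _ _)) _))
  simpa using h_bound

lemma integral_clip_sub_sq_le_add (hn : 0 ≤ n) (f : α → ℝ) (g : ℝ) :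
    ∫ x, (clip n (f x) - g) ^ 2 ∂P ≤ 2 * n ^ 2 + 2 * g ^ 2 := by
  calc ∫ x, (clip n (f x) - g) ^ 2 ∂P ≤ ∫ _, (2 * n ^ 2 + 2 * g ^ 2) ∂P := by
        refine integral_mono_of_nonneg (ae_of_all _ fun x => sq_nonneg _)
          (integrable_const _) (ae_of_all _ fun x => ?_)
        have h_clip : clip n (f x) ^ 2 ≤ n ^ 2 := by
          rw [sq_le_sq, abs_clip hn, abs_of_nonneg hn]
          exact min_le_right _ _
        exact (sub_sq_le_two_mul_add _ _).trans
          (add_le_add_left (mul_le_mul_of_nonneg_left h_clip zero_le_two) _)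
    _ = 2 * n ^ 2 + 2 * g ^ 2 := by simp

end Clip

/-! ### Gaussian tails -/

section Tails

variable {w a l r : ℝ} {s : ℝ≥0}

lemma gaussianReal_real_Ici_le (hr : 0 < r) (hs : s ≤ r) (hwa : w ≤ a) :
    (gaussianReal w s).real (Set.Ici a) ≤ Real.exp (-((a - w) ^ 2 / (2 * r))) := by
  have h_chernoff := measure_ge_le_exp_mul_mgf (μ := gaussianReal w s) (X := id)
    (t := (a - w) / r) a (div_nonneg (by linarith) hr.le) (integrable_exp_mul_gaussianReal _)
  rw [mgf_id_gaussianReal, ← Real.exp_add] at h_chernoff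
  refine h_chernoff.trans (Real.exp_le_exp.2 ?_)
  calc -((a - w) / r) * a + (w * ((a - w) / r) + s * ((a - w) / r) ^ 2 / 2)
      ≤ -((a - w) / r) * a + (w * ((a - w) / r) + r * ((a - w) / r) ^ 2 / 2) := by gcongr
    _ = -((a - w) ^ 2 / (2 * r)) := by
        field_simp
        ring

lemma gaussianReal_real_neg (w : ℝ) (s : ℝ≥0) {A : Set ℝ} (hA : MeasurableSet A) :
    (gaussianReal w s).real (-A) = (gaussianReal (-w) s).real A := by
  rw [← gaussianReal_map_neg, map_measureReal_apply measurable_neg hA]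
  rfl

lemma gaussianReal_real_Icc_neg_le (hr : 0 < r) (hs : s ≤ r) (hl : l ≤ |w|) :
    (gaussianReal w s).real (Set.Icc (-l) l) ≤ Real.exp (-((|w| - l) ^ 2 / (2 * r))) := by
  wlog hw : w ≤ 0 generalizing w
  · have h_neg := this (w := -w) (by rwa [abs_neg]) (neg_nonpos.2 (not_le.1 hw).le)
    rwa [abs_neg, ← gaussianReal_real_neg w s measurableSet_Icc, Set.neg_Icc, neg_neg] at h_neg
  rw [abs_of_nonpos hw] at hl ⊢
  refine (measureReal_mono Set.Icc_subset_Ici_self).trans ?_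
  rw [show -w - l = -l - w by ring]
  exact gaussianReal_real_Ici_le hr hs (by linarith)

lemma gaussianReal_real_Ioi_mul_posMean_neg_sq_le (hs : s ≤ 1) (hl : 0 ≤ l) :
    (gaussianReal w s).real (Set.Ioi l) * posMean (-w) ^ 2 ≤ 4 * Real.exp (-(l ^ 2 / 4)) := by
  have h_tail (hwl : w ≤ l) :
      (gaussianReal w s).real (Set.Ioi l) ≤ Real.exp (-((l - w) ^ 2 / 2)) := by
    have h_ici := gaussianReal_real_Ici_le one_pos (by exact_mod_cast hs) hwl
    rw [mul_one] at h_ici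
    exact (measureReal_mono Set.Ioi_subset_Ici_self).trans h_ici
  have h_posMean (hw : 0 ≤ w) : posMean (-w) ^ 2 ≤ 4 * Real.exp (-w ^ 2) := by
    have h_sq := pow_le_pow_left₀ (posMean_nonneg _) (posMean_neg_le_exp hw) 2
    rw [← Real.exp_nat_mul, show ((2 : ℕ) : ℝ) * -(w ^ 2 / 2) = -w ^ 2 by push_cast; ring] at h_sq
    linarith [Real.exp_pos (-w ^ 2)]
  have h_combine {q P x y : ℝ} (hq : q ≤ Real.exp x) (hP : P ≤ 4 * Real.exp y) (hP0 : 0 ≤ P)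
      (hxy : x + y ≤ -(l ^ 2 / 4)) : q * P ≤ 4 * Real.exp (-(l ^ 2 / 4)) := by
    calc q * P ≤ Real.exp x * (4 * Real.exp y) := by gcongr
      _ = 4 * Real.exp (x + y) := by rw [Real.exp_add]; ring
      _ ≤ 4 * Real.exp (-(l ^ 2 / 4)) := by gcongr
  rcases le_total w 0 with hw | hw
  · have h_sq := posMean_sq_le_exp (-w)
    exact h_combine (h_tail (hw.trans hl)) h_sq (sq_nonneg _) (by nlinarith)
  · rcases le_total w l with hwl | hlw
    · exact h_combine (h_tail hwl) (h_posMean hw) (sq_nonneg _)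
        (by nlinarith [sq_nonneg (l - 2 * w)])
    · exact h_combine (measureReal_le_one.trans Real.exp_zero.ge) (h_posMean hw) (sq_nonneg _)
        (by nlinarith)

lemma gaussianReal_real_Ioi_mul_posMean_neg_le (hs : s ≤ 1) (hl : 0 ≤ l) :
    (gaussianReal w s).real (Set.Ioi l) * posMean (-w) ≤ 2 * Real.exp (-(l ^ 2 / 8)) := by
  set q := (gaussianReal w s).real (Set.Ioi l)
  have : 0 ≤ q := measureReal_nonneg
  have hq_le_one : q ≤ 1 := measureReal_le_one
  refine le_of_sq_le_sq ?_ (by positivity)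
  calc (q * posMean (-w)) ^ 2 = q * (q * posMean (-w) ^ 2) := by ring
    _ ≤ q * posMean (-w) ^ 2 := mul_le_of_le_one_left (by positivity) hq_le_one
    _ ≤ 4 * Real.exp (-(l ^ 2 / 4)) := gaussianReal_real_Ioi_mul_posMean_neg_sq_le hs hl
    _ = (2 * Real.exp (-(l ^ 2 / 8))) ^ 2 := by
        rw [mul_pow, ← Real.exp_nat_mul]
        norm_num
        ring_nf

lemma gaussianReal_real_Iio_neg (w : ℝ) (s : ℝ≥0) (l : ℝ) :
    (gaussianReal w s).real (Set.Iio (-l)) = (gaussianReal (-w) s).real (Set.Ioi l) := by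
  rw [← gaussianReal_real_neg w s measurableSet_Ioi, Set.neg_Ioi]

lemma gaussianReal_real_Iio_mul_posMean_le (hs : s ≤ 1) (hl : 0 ≤ l) :
    (gaussianReal w s).real (Set.Iio (-l)) * posMean w ≤ 2 * Real.exp (-(l ^ 2 / 8)) := by
  rw [gaussianReal_real_Iio_neg]
  simpa only [neg_neg] using gaussianReal_real_Ioi_mul_posMean_neg_le (w := -w) hs hl

lemma gaussianReal_real_Iio_mul_posMean_sq_le (hs : s ≤ 1) (hl : 0 ≤ l) :
    (gaussianReal w s).real (Set.Iio (-l)) * posMean w ^ 2 ≤ 4 * Real.exp (-(l ^ 2 / 4)) := by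
  rw [gaussianReal_real_Iio_neg]
  simpa only [neg_neg] using gaussianReal_real_Ioi_mul_posMean_neg_sq_le (w := -w) hs hl

end Tails

/-! ### Constants of the threshold rule -/

/-- The constraints on the noise ratio `ρ = sp / sf` and the threshold constant `γ` of one
coordinate. -/
structure Admissible (ρ γ : ℝ) : Prop where
  rho_pos : 0 < ρ
  gamma_pos : 0 < γ
  add_sqrt_le : γ + √ρ ≤ 1 / √(4 * Real.exp 1)

/-- The location, in units of `√(2 log n)`, at which the analysis switches regime. The gap
`5 / 4 * √(2 * ρ)` above the threshold constant is chosen so that a mean beyond `cutoff ρ γ` gives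
the middle region a probability small enough (`n ^ (-5 / 4)`) to beat the truncation level `n`,
while below it the Taylor expansion of order `truncOrder` is still accurate. -/
noncomputable def cutoff (ρ γ : ℝ) : ℝ := γ + 5 / 4 * √(2 * ρ)

/-- The number of Hermite terms of degree at least two, as a function of `ℓ = log n`. -/
noncomputable def truncOrder (ρ γ ℓ : ℝ) : ℕ :=
  ⌈Real.exp 1 ^ 2 * (γ + √(2 * ρ)) ^ 2 * (2 * ℓ)⌉₊

namespace Admissible

variable {ρ γ ℓ w : ℝ} {s : ℝ≥0}

lemma rho_le (h : Admissible ρ γ) : ρ ≤ 1 / (4 * Real.exp 1) := by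
  have h_sqrt : √ρ ≤ 1 / √(4 * Real.exp 1) := by linarith [h.add_sqrt_le, h.gamma_pos]
  rwa [one_div, ← Real.sqrt_inv, Real.sqrt_le_sqrt_iff (by positivity), ← one_div] at h_sqrt

lemma two_mul_rho_le_inv (h : Admissible ρ γ) : 2 * ρ ≤ 1 / (2 * Real.exp 1) :=
  calc 2 * ρ ≤ 2 * (1 / (4 * Real.exp 1)) := by gcongr; exact h.rho_le
    _ = 1 / (2 * Real.exp 1) := by
        field_simp
        norm_num

lemma two_mul_rho_le_quarter (h : Admissible ρ γ) : 2 * ρ ≤ 1 / 4 := by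
  refine h.two_mul_rho_le_inv.trans (one_div_le_one_div_of_le (by norm_num) ?_)
  linarith [Real.exp_one_gt_d9]

lemma cutoff_pos (h : Admissible ρ γ) : 0 < cutoff ρ γ := by
  have := h.gamma_pos
  unfold cutoff
  positivity

lemma cutoff_sq_le (h : Admissible ρ γ) : cutoff ρ γ ^ 2 ≤ 25 / (32 * Real.exp 1) := by
  set t := 1 / √(4 * Real.exp 1) with ht
  have ht_sq : t ^ 2 = 1 / (4 * Real.exp 1) := by
    rw [ht, div_pow, Real.sq_sqrt (by positivity), one_pow]
  have h_sqrt_two : 1 ≤ √2 := Real.one_le_sqrt.2 one_le_two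
  have h_le : cutoff ρ γ ≤ 5 / 4 * √2 * t := by
    rw [cutoff, Real.sqrt_mul zero_le_two]
    nlinarith [h.add_sqrt_le, h.gamma_pos]
  calc cutoff ρ γ ^ 2 ≤ (5 / 4 * √2 * t) ^ 2 := by
        gcongr
        exact h.cutoff_pos.le
    _ = 25 / 16 * √2 ^ 2 * t ^ 2 := by ring
    _ = 25 / (32 * Real.exp 1) := by
        rw [Real.sq_sqrt zero_le_two, ht_sq]
        field_simp
        norm_num

lemma two_mul_cutoff_sq_le_one (h : Admissible ρ γ) : 2 * cutoff ρ γ ^ 2 ≤ 1 := by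
  have h_num : 25 / (32 * Real.exp 1) ≤ 1 / 2 := by
    rw [div_le_div_iff₀ (by positivity) zero_lt_two]
    linarith [Real.exp_one_gt_d9]
  linarith [h.cutoff_sq_le]

lemma truncOrder_add_two_le (h : Admissible ρ γ) (hℓ : 0 ≤ ℓ) :
    (truncOrder ρ γ ℓ : ℝ) + 2 ≤ 5 * (1 + ℓ) := by
  have h_ceil := Nat.ceil_lt_add_one (R := ℝ)
    (a := Real.exp 1 ^ 2 * (γ + √(2 * ρ)) ^ 2 * (2 * ℓ)) (by positivity)
  have h_coeff : Real.exp 1 ^ 2 * (γ + √(2 * ρ)) ^ 2 ≤ 5 / 2 := by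
    have h_cutoff : γ + √(2 * ρ) ≤ cutoff ρ γ := by
      unfold cutoff
      linarith [Real.sqrt_nonneg (2 * ρ)]
    have := h.gamma_pos
    calc Real.exp 1 ^ 2 * (γ + √(2 * ρ)) ^ 2 ≤ Real.exp 1 ^ 2 * cutoff ρ γ ^ 2 := by gcongr
      _ ≤ Real.exp 1 ^ 2 * (25 / (32 * Real.exp 1)) := by
          gcongr
          exact h.cutoff_sq_le
      _ = 25 / 32 * Real.exp 1 := by field_simp
      _ ≤ 5 / 2 := by linarith [Real.exp_one_lt_d9]
  unfold truncOrder
  nlinarith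

/-! ### Means below the cutoff -/

lemma sq_le_of_near (h : Admissible ρ γ) (hℓ : 0 ≤ ℓ) (hw : |w| ≤ cutoff ρ γ * √(2 * ℓ)) :
    w ^ 2 ≤ 2 * cutoff ρ γ ^ 2 * ℓ := by
  have := h.cutoff_pos
  calc w ^ 2 = |w| ^ 2 := (sq_abs w).symm
    _ ≤ (cutoff ρ γ * √(2 * ℓ)) ^ 2 := by gcongr
    _ = 2 * cutoff ρ γ ^ 2 * ℓ := by
        rw [mul_pow, Real.sq_sqrt (by positivity)]
        ring

lemma sq_le_self_of_near (h : Admissible ρ γ) (hℓ : 0 ≤ ℓ)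
    (hw : |w| ≤ cutoff ρ γ * √(2 * ℓ)) : w ^ 2 ≤ ℓ :=
  (h.sq_le_of_near hℓ hw).trans (mul_le_of_le_one_left hℓ h.two_mul_cutoff_sq_le_one)

lemma sq_div_le_of_near (h : Admissible ρ γ) (hs : s ≤ 2 * ρ) (hℓ : 0 ≤ ℓ)
    (hw : |w| ≤ cutoff ρ γ * √(2 * ℓ)) : w ^ 2 / (1 - s) ≤ 3 / 4 * ℓ := by
  have h_inv := h.two_mul_rho_le_inv
  have h_num : 2 * (25 / (32 * Real.exp 1)) ≤ 3 / 4 * (1 - 1 / (2 * Real.exp 1)) := by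
    field_simp
    linarith [Real.exp_one_gt_d9]
  rw [div_le_iff₀ (by linarith [h.two_mul_rho_le_quarter])]
  calc w ^ 2 ≤ 2 * cutoff ρ γ ^ 2 * ℓ := h.sq_le_of_near hℓ hw
    _ ≤ 2 * (25 / (32 * Real.exp 1)) * ℓ := by
        gcongr
        exact h.cutoff_sq_le
    _ ≤ 3 / 4 * (1 - 1 / (2 * Real.exp 1)) * ℓ := by gcongr
    _ ≤ 3 / 4 * (1 - s) * ℓ := by
        gcongr
        linarith
    _ = 3 / 4 * ℓ * (1 - s) := by ring

lemma integral_hermEst_sq_le_of_near (h : Admissible ρ γ) (hs : s ≤ 2 * ρ) (hℓ : 0 ≤ ℓ)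
    (hw : |w| ≤ cutoff ρ γ * √(2 * ℓ)) {β : ℝ} (hβ : β ∈ Set.Icc (0 : ℝ) 1) :
    ∫ u, hermEst β s (truncOrder ρ γ ℓ + 2) u ^ 2 ∂(gaussianReal w s) ≤
      25 * (1 + ℓ) ^ 2 * Real.exp (3 / 4 * ℓ) := by
  have hs_lt : s < 1 := by
    have h_real : (s : ℝ) < 1 := by linarith [h.two_mul_rho_le_quarter]
    exact_mod_cast h_real
  have h_order := h.truncOrder_add_two_le hℓ
  calc ∫ u, hermEst β s (truncOrder ρ γ ℓ + 2) u ^ 2 ∂(gaussianReal w s)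
      ≤ ((truncOrder ρ γ ℓ + 2 : ℕ) : ℝ) ^ 2 * Real.exp (w ^ 2 / (1 - s)) :=
        integral_hermEst_sq_le hβ hs_lt _ w
    _ ≤ (5 * (1 + ℓ)) ^ 2 * Real.exp (3 / 4 * ℓ) := by
        push_cast
        gcongr
        exact h.sq_div_le_of_near hs hℓ hw
    _ = 25 * (1 + ℓ) ^ 2 * Real.exp (3 / 4 * ℓ) := by ring

end Admissible

lemma pow_div_factorial_le_exp_of_le {x a : ℝ} (hx : 0 ≤ x) (J : ℕ)
    (hxJ : x ≤ J * Real.exp (-a)) : x ^ J / (J.factorial : ℝ) ≤ Real.exp ((1 - a) * J) :=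
  calc x ^ J / (J.factorial : ℝ) ≤ (J * Real.exp (-a)) ^ J / (J.factorial : ℝ) := by gcongr
    _ = (J : ℝ) ^ J / (J.factorial : ℝ) * Real.exp (-a) ^ J := by
        rw [mul_pow]
        ring
    _ ≤ Real.exp J * Real.exp (-a) ^ J := by
        gcongr
        exact Real.pow_div_factorial_le_exp _ (Nat.cast_nonneg J) J
    _ = Real.exp ((1 - a) * J) := by
        rw [← Real.exp_nat_mul, ← Real.exp_add]
        ring_nf

namespace Admissible

variable {ρ γ ℓ w : ℝ} {s : ℝ≥0}

lemma sq_div_two_le_of_near (h : Admissible ρ γ) (hℓ : 0 ≤ ℓ)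
    (hw : |w| ≤ cutoff ρ γ * √(2 * ℓ)) {J : ℝ} (hJ : truncOrder ρ γ ℓ ≤ 2 * J) :
    w ^ 2 / 2 ≤ J * Real.exp (-(3 / 2)) := by
  have hγ := h.gamma_pos
  have h_cutoff : cutoff ρ γ ≤ 5 / 4 * (γ + √(2 * ρ)) := by
    unfold cutoff
    linarith
  have h_ceil : Real.exp 1 ^ 2 * (γ + √(2 * ρ)) ^ 2 * (2 * ℓ) ≤ 2 * J := (Nat.le_ceil _).trans hJ
  have hJ_nonneg : 0 ≤ J := by
    have : (0 : ℝ) ≤ truncOrder ρ γ ℓ := Nat.cast_nonneg _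
    linarith
  have h_num : (25 / 16 : ℝ) ≤ Real.exp (1 / 2) := by
    linarith [Real.quadratic_le_exp_of_nonneg (x := (1 / 2 : ℝ)) (by norm_num)]
  have h_exp : Real.exp (1 / 2) = Real.exp (-(3 / 2)) * Real.exp 1 ^ 2 := by
    rw [← Real.exp_nat_mul, ← Real.exp_add]
    norm_num
  refine le_of_mul_le_mul_right (a := Real.exp 1 ^ 2) ?_ (by positivity)
  calc w ^ 2 / 2 * Real.exp 1 ^ 2 ≤ 2 * cutoff ρ γ ^ 2 * ℓ / 2 * Real.exp 1 ^ 2 := by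
        gcongr
        exact h.sq_le_of_near hℓ hw
    _ ≤ 2 * (5 / 4 * (γ + √(2 * ρ))) ^ 2 * ℓ / 2 * Real.exp 1 ^ 2 := by
        have := h.cutoff_pos
        gcongr
    _ = 25 / 32 * (Real.exp 1 ^ 2 * (γ + √(2 * ρ)) ^ 2 * (2 * ℓ)) := by ring
    _ ≤ 25 / 32 * (2 * J) := by gcongr
    _ = J * (25 / 16) := by ring
    _ ≤ J * Real.exp (1 / 2) := by gcongr
    _ = J * Real.exp (-(3 / 2)) * Real.exp 1 ^ 2 := by rw [h_exp, mul_assoc]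

lemma gamma_sq_mul_le (h : Admissible ρ γ) (hℓ : 0 ≤ ℓ) {J : ℝ}
    (hJ : truncOrder ρ γ ℓ ≤ 2 * J) : γ ^ 2 * ℓ ≤ J / 2 := by
  have hγ := h.gamma_pos
  have h_ceil : Real.exp 1 ^ 2 * (γ + √(2 * ρ)) ^ 2 * (2 * ℓ) ≤ 2 * J := (Nat.le_ceil _).trans hJ
  have h_sqrt : γ ≤ γ + √(2 * ρ) := le_add_of_nonneg_right (Real.sqrt_nonneg _)
  have h_exp : 2 ≤ Real.exp 1 ^ 2 := by nlinarith [Real.exp_one_gt_d9]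
  calc γ ^ 2 * ℓ = 2 * γ ^ 2 * (2 * ℓ) / 4 := by ring
    _ ≤ Real.exp 1 ^ 2 * (γ + √(2 * ρ)) ^ 2 * (2 * ℓ) / 4 := by gcongr
    _ ≤ J / 2 := by linarith

lemma abs_taylorG_sub_G_le_of_near (h : Admissible ρ γ) (hℓ : 0 ≤ ℓ)
    (hw : |w| ≤ cutoff ρ γ * √(2 * ℓ)) (β : ℝ) :
    |taylorG β (truncOrder ρ γ ℓ + 2) w - G w β| ≤ ℓ * Real.exp (-(γ ^ 2 * ℓ)) := by
  set J := (truncOrder ρ γ ℓ + 1) / 2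
  have hJ : (truncOrder ρ γ ℓ : ℝ) ≤ 2 * (J : ℝ) := by
    have h_nat : truncOrder ρ γ ℓ ≤ 2 * J := by lia
    exact_mod_cast h_nat
  have h_coeff : (w ^ 2 / 2) ^ J / (J.factorial : ℝ) ≤ Real.exp (-(γ ^ 2 * ℓ)) := by
    refine (pow_div_factorial_le_exp_of_le (by positivity) J
      (h.sq_div_two_le_of_near hℓ hw hJ)).trans (Real.exp_le_exp.2 ?_)
    linarith [h.gamma_sq_mul_le hℓ hJ]
  rw [abs_sub_comm]
  calc |G w β - taylorG β (truncOrder ρ γ ℓ + 2) w|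
      ≤ (w ^ 2 / 2) ^ J / (J.factorial : ℝ) * w ^ 2 := abs_G_sub_taylorG_le β _ w
    _ ≤ Real.exp (-(γ ^ 2 * ℓ)) * ℓ := by
        gcongr
        exact h.sq_le_self_of_near hℓ hw
    _ = ℓ * Real.exp (-(γ ^ 2 * ℓ)) := mul_comm _ _

/-! ### Means above the cutoff -/

lemma measureReal_Icc_le_of_far (h : Admissible ρ γ) (hs : s ≤ 2 * ρ) (hℓ : 0 ≤ ℓ)
    (hw : cutoff ρ γ * √(2 * ℓ) ≤ |w|) :
    (gaussianReal w s).real (Set.Icc (-(γ * √(2 * ℓ))) (γ * √(2 * ℓ))) ≤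
      Real.exp (-(5 / 4 * ℓ)) * Real.exp (-(2 / 5 * (|w| - γ * √(2 * ℓ)) ^ 2)) := by
  have hρ := h.rho_pos
  set y := |w| - γ * √(2 * ℓ) with hy
  have hy_ge : 5 / 4 * √(2 * ρ) * √(2 * ℓ) ≤ y := by
    rw [hy]
    unfold cutoff at hw
    linarith
  have hy_nonneg : 0 ≤ y := le_trans (by positivity) hy_ge
  have h_log : 25 / 16 * ℓ ≤ y ^ 2 / (2 * (2 * ρ)) := by
    rw [le_div_iff₀ (by positivity)]
    calc 25 / 16 * ℓ * (2 * (2 * ρ)) = (5 / 4 * √(2 * ρ) * √(2 * ℓ)) ^ 2 := by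
          rw [mul_pow, mul_pow, Real.sq_sqrt (by positivity), Real.sq_sqrt (by positivity)]
          ring
      _ ≤ y ^ 2 := by gcongr
  have h_sq : 2 * y ^ 2 ≤ y ^ 2 / (2 * (2 * ρ)) := by
    rw [le_div_iff₀ (by positivity)]
    nlinarith [h.two_mul_rho_le_quarter, sq_nonneg y]
  rw [← Real.exp_add]
  refine (gaussianReal_real_Icc_neg_le (by positivity) hs (sub_nonneg.1 hy_nonneg)).trans ?_
  exact Real.exp_le_exp.2 (by linarith)

lemma measureReal_Icc_le_exp_of_far (h : Admissible ρ γ) (hs : s ≤ 2 * ρ) (hℓ : 0 ≤ ℓ)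
    (hw : cutoff ρ γ * √(2 * ℓ) ≤ |w|) :
    (gaussianReal w s).real (Set.Icc (-(γ * √(2 * ℓ))) (γ * √(2 * ℓ))) ≤
      Real.exp (-(5 / 4 * ℓ)) := by
  refine (h.measureReal_Icc_le_of_far hs hℓ hw).trans
    (mul_le_of_le_one_right (Real.exp_pos _).le (Real.exp_le_one_iff.2 ?_))
  nlinarith [sq_nonneg (|w| - γ * √(2 * ℓ))]

lemma measureReal_Icc_mul_sq_le_of_far (h : Admissible ρ γ) (hs : s ≤ 2 * ρ) (hℓ : 0 ≤ ℓ)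
    (hw : cutoff ρ γ * √(2 * ℓ) ≤ |w|) :
    (gaussianReal w s).real (Set.Icc (-(γ * √(2 * ℓ))) (γ * √(2 * ℓ))) * (1 + |w|) ^ 2 ≤
      8 * (1 + ℓ) * Real.exp (-(5 / 4 * ℓ)) := by
  have h_prob := h.measureReal_Icc_le_of_far hs hℓ hw
  set l := γ * √(2 * ℓ) with hl
  set y := |w| - l with hy
  have hl_sq : l ^ 2 ≤ ℓ := by
    have h_le : l ≤ cutoff ρ γ * √(2 * ℓ) := by
      rw [hl]
      unfold cutoff
      gcongr
      exact le_add_of_nonneg_right (by positivity)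
    have hl_nonneg : 0 ≤ l := mul_nonneg h.gamma_pos.le (Real.sqrt_nonneg _)
    exact h.sq_le_self_of_near hℓ ((abs_of_nonneg hl_nonneg).trans_le h_le)
  have hw_sq : (1 + |w|) ^ 2 ≤ 3 * (1 + ℓ) * (1 + y ^ 2) := by
    rw [show |w| = y + l by rw [hy]; ring]
    nlinarith [sq_nonneg (1 - y), sq_nonneg (1 - l), sq_nonneg (y - l),
      mul_nonneg hℓ (sq_nonneg y)]
  have h_exp : (1 + y ^ 2) * Real.exp (-(2 / 5 * y ^ 2)) ≤ 5 / 2 := by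
    rw [Real.exp_neg, ← div_eq_mul_inv, div_le_iff₀ (Real.exp_pos _)]
    linarith [Real.add_one_le_exp (2 / 5 * y ^ 2)]
  calc (gaussianReal w s).real (Set.Icc (-l) l) * (1 + |w|) ^ 2
      ≤ Real.exp (-(5 / 4 * ℓ)) * Real.exp (-(2 / 5 * y ^ 2)) *
          (3 * (1 + ℓ) * (1 + y ^ 2)) := by gcongr
    _ = 3 * (1 + ℓ) * Real.exp (-(5 / 4 * ℓ)) *
          ((1 + y ^ 2) * Real.exp (-(2 / 5 * y ^ 2))) := by ring
    _ ≤ 3 * (1 + ℓ) * Real.exp (-(5 / 4 * ℓ)) * (5 / 2) := by gcongr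
    _ = 15 / 2 * (1 + ℓ) * Real.exp (-(5 / 4 * ℓ)) := by ring
    _ ≤ 8 * (1 + ℓ) * Real.exp (-(5 / 4 * ℓ)) := by
        gcongr
        norm_num

end Admissible

/-! ### The truncated Hermite estimator -/

namespace Admissible

variable {ρ γ ℓ w β δ : ℝ} {s : ℝ≥0}

lemma abs_integral_clip_hermEst_sub_le_of_near (h : Admissible ρ γ) (hs : s ≤ 2 * ρ)
    (hℓ : 0 ≤ ℓ) (hw : |w| ≤ cutoff ρ γ * √(2 * ℓ)) (hβ : β ∈ Set.Icc (0 : ℝ) 1) :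
    |∫ u, (clip (Real.exp ℓ) (hermEst β s (truncOrder ρ γ ℓ + 2) u) - G w β)
        ∂(gaussianReal w s)| ≤
      25 * (1 + ℓ) ^ 2 * Real.exp (-(1 / 4 * ℓ)) + ℓ * Real.exp (-(γ ^ 2 * ℓ)) := by
  have h_bias := abs_integral_clip_sub_le (Real.exp_pos ℓ)
    (memLp_hermEst β s (truncOrder ρ γ ℓ + 2) w s) (G w β)
  rw [integral_hermEst] at h_bias
  refine h_bias.trans (add_le_add ?_ (h.abs_taylorG_sub_G_le_of_near hℓ hw β))
  rw [div_le_iff₀ (Real.exp_pos ℓ), mul_assoc, ← Real.exp_add,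
    show -(1 / 4 * ℓ) + ℓ = 3 / 4 * ℓ by ring]
  exact h.integral_hermEst_sq_le_of_near hs hℓ hw hβ

lemma integral_clip_hermEst_sub_sq_le_of_near (h : Admissible ρ γ) (hs : s ≤ 2 * ρ)
    (hℓ : 0 ≤ ℓ) (hw : |w| ≤ cutoff ρ γ * √(2 * ℓ)) (hβ : β ∈ Set.Icc (0 : ℝ) 1) :
    ∫ u, (clip (Real.exp ℓ) (hermEst β s (truncOrder ρ γ ℓ + 2) u) - G w β) ^ 2
        ∂(gaussianReal w s) ≤
      54 * (1 + ℓ) ^ 2 * Real.exp (3 / 4 * ℓ) := by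
  have h_mse := integral_clip_sub_sq_le (Real.exp_pos ℓ).le
    (memLp_hermEst β s (truncOrder ρ γ ℓ + 2) w s) (G w β)
  have h_hermEst := h.integral_hermEst_sq_le_of_near hs hℓ hw hβ
  have h_G : G w β ^ 2 ≤ 2 * (1 + ℓ) ^ 2 := by
    have h_abs : G w β ^ 2 ≤ (1 + |w|) ^ 2 := by
      rw [← sq_abs (G w β)]
      gcongr
      exact abs_G_le hβ w
    nlinarith [sq_nonneg (1 - |w|), sq_abs w, h.sq_le_self_of_near hℓ hw]
  have h_exp : (1 + ℓ) ^ 2 ≤ (1 + ℓ) ^ 2 * Real.exp (3 / 4 * ℓ) :=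
    le_mul_of_one_le_right (sq_nonneg _) (Real.one_le_exp (by positivity))
  linarith

lemma measureReal_Icc_mul_abs_integral_clip_sub_le_of_far (h : Admissible ρ γ) (hs : s ≤ 2 * ρ)
    (hℓ : 0 ≤ ℓ) (hw : cutoff ρ γ * √(2 * ℓ) ≤ |w|) (hβ : β ∈ Set.Icc (0 : ℝ) 1) (f : ℝ → ℝ) :
    (gaussianReal w s).real (Set.Icc (-(γ * √(2 * ℓ))) (γ * √(2 * ℓ))) *
        |∫ u, (clip (Real.exp ℓ) (f u) - G w β) ∂(gaussianReal w s)| ≤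
      9 * (1 + ℓ) * Real.exp (-(1 / 4 * ℓ)) := by
  set p := (gaussianReal w s).real (Set.Icc (-(γ * √(2 * ℓ))) (γ * √(2 * ℓ)))
  have hp_exp : p ≤ Real.exp (-(5 / 4 * ℓ)) := h.measureReal_Icc_le_exp_of_far hs hℓ hw
  have hp_sq := h.measureReal_Icc_mul_sq_le_of_far hs hℓ hw
  have h_exp_mul : Real.exp (-(5 / 4 * ℓ)) * Real.exp ℓ = Real.exp (-(1 / 4 * ℓ)) := by
    rw [← Real.exp_add]
    ring_nf
  calc p * |∫ u, (clip (Real.exp ℓ) (f u) - G w β) ∂(gaussianReal w s)|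
      ≤ p * (Real.exp ℓ + (1 + |w|) ^ 2) := by
        gcongr
        refine (abs_integral_clip_sub_le_add (Real.exp_pos ℓ).le f _).trans ?_
        gcongr
        exact (abs_G_le hβ w).trans (le_self_pow₀ (by linarith [abs_nonneg w]) two_ne_zero)
    _ = p * Real.exp ℓ + p * (1 + |w|) ^ 2 := by ring
    _ ≤ Real.exp (-(5 / 4 * ℓ)) * Real.exp ℓ + 8 * (1 + ℓ) * Real.exp (-(5 / 4 * ℓ)) := by gcongr
    _ ≤ (1 + ℓ) * Real.exp (-(1 / 4 * ℓ)) + 8 * (1 + ℓ) * Real.exp (-(1 / 4 * ℓ)) := by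
        rw [h_exp_mul]
        gcongr
        · exact le_mul_of_one_le_left (Real.exp_pos _).le (by linarith)
        · norm_num
    _ = 9 * (1 + ℓ) * Real.exp (-(1 / 4 * ℓ)) := by ring

lemma measureReal_Icc_mul_integral_clip_sub_sq_le_of_far (h : Admissible ρ γ) (hs : s ≤ 2 * ρ)
    (hℓ : 0 ≤ ℓ) (hw : cutoff ρ γ * √(2 * ℓ) ≤ |w|) (hβ : β ∈ Set.Icc (0 : ℝ) 1) (f : ℝ → ℝ) :
    (gaussianReal w s).real (Set.Icc (-(γ * √(2 * ℓ))) (γ * √(2 * ℓ))) *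
        ∫ u, (clip (Real.exp ℓ) (f u) - G w β) ^ 2 ∂(gaussianReal w s) ≤
      18 * (1 + ℓ) * Real.exp (3 / 4 * ℓ) := by
  set p := (gaussianReal w s).real (Set.Icc (-(γ * √(2 * ℓ))) (γ * √(2 * ℓ)))
  have hp_exp : p ≤ Real.exp (-(5 / 4 * ℓ)) := h.measureReal_Icc_le_exp_of_far hs hℓ hw
  have hp_sq := h.measureReal_Icc_mul_sq_le_of_far hs hℓ hw
  have h_exp_mul : Real.exp (-(5 / 4 * ℓ)) * Real.exp ℓ ^ 2 = Real.exp (3 / 4 * ℓ) := by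
    rw [← Real.exp_nat_mul, ← Real.exp_add]
    push_cast
    ring_nf
  calc p * ∫ u, (clip (Real.exp ℓ) (f u) - G w β) ^ 2 ∂(gaussianReal w s)
      ≤ p * (2 * Real.exp ℓ ^ 2 + 2 * (1 + |w|) ^ 2) := by
        gcongr
        refine (integral_clip_sub_sq_le_add (Real.exp_pos ℓ).le f _).trans ?_
        rw [← sq_abs (G w β)]
        gcongr
        exact abs_G_le hβ w
    _ = 2 * (p * Real.exp ℓ ^ 2) + 2 * (p * (1 + |w|) ^ 2) := by ring
    _ ≤ 2 * (Real.exp (-(5 / 4 * ℓ)) * Real.exp ℓ ^ 2) +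
          2 * (8 * (1 + ℓ) * Real.exp (-(5 / 4 * ℓ))) := by gcongr
    _ ≤ 2 * ((1 + ℓ) * Real.exp (3 / 4 * ℓ)) + 2 * (8 * (1 + ℓ) * Real.exp (3 / 4 * ℓ)) := by
        rw [h_exp_mul]
        gcongr
        · exact le_mul_of_one_le_left (Real.exp_pos _).le (by linarith)
        · linarith
    _ = 18 * (1 + ℓ) * Real.exp (3 / 4 * ℓ) := by ring

lemma measureReal_Icc_mul_abs_integral_clip_hermEst_sub_le (h : Admissible ρ γ)
    (hs : s ≤ 2 * ρ) (hℓ : 0 ≤ ℓ) (hβ : β ∈ Set.Icc (0 : ℝ) 1)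
    (hδ : δ ≤ 1 / 4) (hδγ : δ ≤ γ ^ 2) :
    (gaussianReal w s).real (Set.Icc (-(γ * √(2 * ℓ))) (γ * √(2 * ℓ))) *
        |∫ u, (clip (Real.exp ℓ) (hermEst β s (truncOrder ρ γ ℓ + 2) u) - G w β)
          ∂(gaussianReal w s)| ≤
      26 * (1 + ℓ) ^ 2 * Real.exp (-(δ * ℓ)) := by
  have h_exp_quarter : Real.exp (-(1 / 4 * ℓ)) ≤ Real.exp (-(δ * ℓ)) := by gcongr
  have h_exp_gamma : Real.exp (-(γ ^ 2 * ℓ)) ≤ Real.exp (-(δ * ℓ)) := by gcongr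
  rcases le_total |w| (cutoff ρ γ * √(2 * ℓ)) with hw | hw
  · refine (mul_le_of_le_one_left (abs_nonneg _) measureReal_le_one).trans ?_
    calc _ ≤ 25 * (1 + ℓ) ^ 2 * Real.exp (-(1 / 4 * ℓ)) + ℓ * Real.exp (-(γ ^ 2 * ℓ)) :=
          h.abs_integral_clip_hermEst_sub_le_of_near hs hℓ hw hβ
      _ ≤ 25 * (1 + ℓ) ^ 2 * Real.exp (-(δ * ℓ)) + (1 + ℓ) ^ 2 * Real.exp (-(δ * ℓ)) := by
          gcongr
          nlinarith
      _ = 26 * (1 + ℓ) ^ 2 * Real.exp (-(δ * ℓ)) := by ring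
  · refine (h.measureReal_Icc_mul_abs_integral_clip_sub_le_of_far hs hℓ hw hβ _).trans ?_
    gcongr
    · norm_num
    · nlinarith

lemma measureReal_Icc_mul_integral_clip_hermEst_sub_sq_le (h : Admissible ρ γ)
    (hs : s ≤ 2 * ρ) (hℓ : 0 ≤ ℓ) (hβ : β ∈ Set.Icc (0 : ℝ) 1) :
    (gaussianReal w s).real (Set.Icc (-(γ * √(2 * ℓ))) (γ * √(2 * ℓ))) *
        ∫ u, (clip (Real.exp ℓ) (hermEst β s (truncOrder ρ γ ℓ + 2) u) - G w β) ^ 2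
          ∂(gaussianReal w s) ≤
      54 * (1 + ℓ) ^ 2 * Real.exp (3 / 4 * ℓ) := by
  rcases le_total |w| (cutoff ρ γ * √(2 * ℓ)) with hw | hw
  · exact (mul_le_of_le_one_left (integral_nonneg fun u => sq_nonneg _) measureReal_le_one).trans
      (h.integral_clip_hermEst_sub_sq_le_of_near hs hℓ hw hβ)
  · refine (h.measureReal_Icc_mul_integral_clip_sub_sq_le_of_far hs hℓ hw hβ _).trans ?_
    gcongr
    · norm_num
    · nlinarith

end Admissible

/-! ### One coordinate -/

lemma integral_mul_sub_gaussianReal (r a w : ℝ) (v : ℝ≥0) :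
    ∫ u, (r * u - a) ∂(gaussianReal w v) = r * w - a := by
  rw [integral_sub ((integrable_id_gaussianReal w v).const_mul r) (integrable_const _),
    integral_const_mul, integral_id_gaussianReal, integral_const, probReal_univ, one_smul]

lemma memLp_mul_gaussianReal (r w : ℝ) (v : ℝ≥0) :
    MemLp (fun u => r * u) 2 (gaussianReal w v) :=
  (memLp_id_gaussianReal 2).const_mul r

lemma integral_mul_sub_sq_gaussianReal (r a w : ℝ) (v : ℝ≥0) :
    ∫ u, (r * u - a) ^ 2 ∂(gaussianReal w v) = r ^ 2 * v + (r * w - a) ^ 2 := by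
  have h_var : Var[fun u => r * u - a; gaussianReal w v] = r ^ 2 * v := by
    rw [variance_sub_const (X := fun u => r * u) (by fun_prop), variance_const_mul,
      variance_fun_id_gaussianReal]
  have h_memLp : MemLp (fun u => r * u - a) 2 (gaussianReal w v) :=
    (memLp_mul_gaussianReal r w v).sub (memLp_const a)
  rw [variance_eq_sub h_memLp, integral_mul_sub_gaussianReal] at h_var
  simp only [Pi.pow_apply] at h_var
  linarith

namespace Coord

variable (C : Coord)

lemma ratio_mem_Icc : C.ratio ∈ Set.Icc (0 : ℝ) 1 := by
  have := C.b_pos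
  have := C.h_pos
  refine ⟨by unfold ratio; positivity, ?_⟩
  rw [ratio, div_le_one (by positivity)]
  linarith

lemma shrink_mem_Icc (τ : ℝ≥0∞) : C.shrink τ ∈ Set.Icc (0 : ℝ) 1 := by
  have h_sp : (0 : ℝ) < C.sp := C.sp_pos
  have : 0 ≤ τ.toReal := ENNReal.toReal_nonneg
  unfold shrink
  split_ifs
  · simp
  · exact ⟨by positivity, (div_le_one (by positivity)).2 (by linarith)⟩

/-- The argument `c + d θ` at which `G` is evaluated in the risk. -/
noncomputable def arg (τ : ℝ≥0∞) (θ : ℝ) : ℝ := C.c τ + C.d τ * θ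

/-- The common variance `2 sp d²` of the two randomized arguments `c + d (X ± √sp Z)`. -/
noncomputable def noiseVar (τ : ℝ≥0∞) : ℝ≥0 := .mk (2 * C.sp * C.d τ ^ 2) (by positivity)

lemma noiseVar_le (τ : ℝ≥0∞) : (C.noiseVar τ : ℝ) ≤ 2 * (C.sp / C.sf) := by
  obtain ⟨h_nonneg, h_le_one⟩ := C.shrink_mem_Icc τ
  have h_sf : (0 : ℝ) < C.sf := C.sf_pos
  have h_d : C.d τ ^ 2 ≤ 1 / C.sf := by
    rw [d, neg_sq, div_pow, Real.sq_sqrt (by positivity)]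
    gcongr
    · exact pow_le_one₀ (by linarith) (by linarith)
    · exact le_add_of_nonneg_right (by positivity)
  calc (C.noiseVar τ : ℝ) = 2 * C.sp * C.d τ ^ 2 := rfl
    _ ≤ 2 * C.sp * (1 / C.sf) := by gcongr
    _ = 2 * (C.sp / C.sf) := by ring

lemma S_eq_hermEst (γ : ℝ) (n : ℕ) (τ : ℝ≥0∞) : C.S γ n τ =
    hermEst C.ratio (C.noiseVar τ) (truncOrder (C.sp / C.sf) γ (Real.log n) + 2) := by
  have h_order : C.order γ n - 1 = truncOrder (C.sp / C.sf) γ (Real.log n) := by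
    rw [order, Nat.add_sub_cancel_left, mul_div_assoc, truncOrder]
  ext u
  rw [S, h_order, hermEst, Finset.sum_range_succ', Finset.sum_range_succ', scaledHerm_zero,
    scaledHerm_one (C.noiseVar τ).coe_nonneg, (hasDerivAt_G 0 C.ratio).deriv, Finset.mul_sum]
  simp only [taylorCoeff, mul_assoc, noiseVar, NNReal.coe_mk]
  ring

lemma STrunc_eq_clip (γ : ℝ) (n : ℕ) (τ : ℝ≥0∞) (u : ℝ) : C.STrunc γ n τ u =
    clip n (hermEst C.ratio (C.noiseVar τ) (truncOrder (C.sp / C.sf) γ (Real.log n) + 2) u) := by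
  rw [STrunc, sign_mul_min_abs n.cast_nonneg, S_eq_hermEst]

lemma memLp_STrunc (γ : ℝ) (n : ℕ) (τ : ℝ≥0∞) (w : ℝ) (v : ℝ≥0) :
    MemLp (C.STrunc γ n τ) 2 (gaussianReal w v) := by
  simp only [funext (C.STrunc_eq_clip γ n τ)]
  exact memLp_clip n.cast_nonneg (continuous_hermEst _ _ _).aestronglyMeasurable 2

/-- The arguments `u` and `v` of the randomized estimate at observation `p.1` and noise `p.2`. -/
noncomputable def randomize (τ : ℝ≥0∞) (p : ℝ × ℝ) : ℝ × ℝ :=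
  (C.c τ + C.d τ * (p.1 + √(C.sp : ℝ) * p.2), C.c τ + C.d τ * (p.1 - √(C.sp : ℝ) * p.2))

lemma measurePreserving_randomize (τ : ℝ≥0∞) (θ : ℝ) :
    MeasurePreserving (C.randomize τ) ((gaussianReal θ C.sp).prod (gaussianReal 0 1))
      ((gaussianReal (C.arg τ θ) (C.noiseVar τ)).prod
        (gaussianReal (C.arg τ θ) (C.noiseVar τ))) where
  measurable := by
    unfold randomize
    fun_prop
  map_eq := map_affine_add_sub_prod_gaussianReal θ (C.c τ) (C.d τ) C.sp (C.noiseVar τ) rfl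

lemma T_eq_integral_threshold (γ : ℝ) (n : ℕ) (τ : ℝ≥0∞) (x : ℝ) : C.T γ n τ x =
    ∫ z, threshold (thr γ n) (-C.ratio * ·) (C.STrunc γ n τ) ((1 - C.ratio) * ·)
      (C.randomize τ (x, z)) ∂(gaussianReal 0 1) :=
  rfl

lemma neg_ratio_mul_sub_G (w : ℝ) : -C.ratio * w - G w C.ratio = -posMean w := by
  rw [G_eq_posMean_sub]
  ring

lemma one_sub_ratio_mul_sub_G (w : ℝ) : (1 - C.ratio) * w - G w C.ratio = -posMean (-w) := by
  rw [G_eq_convex_combination]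
  linear_combination -(1 - C.ratio) * posMean_sub_posMean_neg w

section Moments

variable {γ : ℝ} (hγ : 0 ≤ γ) (n : ℕ) (τ : ℝ≥0∞) (θ : ℝ)

include hγ

lemma thr_nonneg : 0 ≤ thr γ n := mul_nonneg hγ (Real.sqrt_nonneg _)

lemma memLp_T : MemLp (C.T γ n τ) 2 (gaussianReal θ C.sp) := by
  rw [funext (C.T_eq_integral_threshold γ n τ)]
  exact memLp_integral_threshold_comp (C.measurePreserving_randomize τ θ) (thr_nonneg hγ n)
    (memLp_mul_gaussianReal _ _ _) (C.memLp_STrunc γ n τ _ _) (memLp_mul_gaussianReal _ _ _)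

lemma integral_T_sub_G :
    ∫ x, (C.T γ n τ x - G (C.arg τ θ) C.ratio) ∂(gaussianReal θ C.sp) =
      (gaussianReal (C.arg τ θ) (C.noiseVar τ)).real (Set.Iio (-thr γ n)) *
          -posMean (C.arg τ θ) +
        (gaussianReal (C.arg τ θ) (C.noiseVar τ)).real (Set.Icc (-thr γ n) (thr γ n)) *
          ∫ u, (C.STrunc γ n τ u - G (C.arg τ θ) C.ratio)
            ∂(gaussianReal (C.arg τ θ) (C.noiseVar τ)) +
        (gaussianReal (C.arg τ θ) (C.noiseVar τ)).real (Set.Ioi (thr γ n)) *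
          -posMean (-C.arg τ θ) := by
  rw [← neg_ratio_mul_sub_G, ← one_sub_ratio_mul_sub_G,
    ← integral_mul_sub_gaussianReal (-C.ratio) _ _ (C.noiseVar τ),
    ← integral_mul_sub_gaussianReal (1 - C.ratio) _ _ (C.noiseVar τ)]
  simp only [T_eq_integral_threshold]
  exact integral_integral_threshold_comp_sub (C.measurePreserving_randomize τ θ)
    (thr_nonneg hγ n) (memLp_mul_gaussianReal _ _ _) (C.memLp_STrunc γ n τ _ _)
    (memLp_mul_gaussianReal _ _ _) _

lemma integral_T_sub_G_sq_le :
    ∫ x, (C.T γ n τ x - G (C.arg τ θ) C.ratio) ^ 2 ∂(gaussianReal θ C.sp) ≤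
      (gaussianReal (C.arg τ θ) (C.noiseVar τ)).real (Set.Iio (-thr γ n)) *
          (C.noiseVar τ + posMean (C.arg τ θ) ^ 2) +
        (gaussianReal (C.arg τ θ) (C.noiseVar τ)).real (Set.Icc (-thr γ n) (thr γ n)) *
          ∫ u, (C.STrunc γ n τ u - G (C.arg τ θ) C.ratio) ^ 2
            ∂(gaussianReal (C.arg τ θ) (C.noiseVar τ)) +
        (gaussianReal (C.arg τ θ) (C.noiseVar τ)).real (Set.Ioi (thr γ n)) *
          (C.noiseVar τ + posMean (-C.arg τ θ) ^ 2) := by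
  obtain ⟨h_nonneg, h_le_one⟩ := C.ratio_mem_Icc
  simp only [T_eq_integral_threshold]
  refine (integral_integral_threshold_comp_sub_sq_le (C.measurePreserving_randomize τ θ)
    (thr_nonneg hγ n) (memLp_mul_gaussianReal _ _ _) (C.memLp_STrunc γ n τ _ _)
    (memLp_mul_gaussianReal _ _ _) _).trans ?_
  simp only [integral_mul_sub_sq_gaussianReal, neg_ratio_mul_sub_G, one_sub_ratio_mul_sub_G, neg_sq]
  gcongr
  · exact mul_le_of_le_one_left (NNReal.coe_nonneg _) (pow_le_one₀ h_nonneg h_le_one)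
  · exact mul_le_of_le_one_left (NNReal.coe_nonneg _)
      (pow_le_one₀ (sub_nonneg.2 h_le_one) (sub_le_self _ h_nonneg))

end Moments

section Bounds

variable {γ : ℝ} (h : Admissible (C.sp / C.sf) γ) {n : ℕ} (hn : 1 ≤ n) (τ : ℝ≥0∞) (θ : ℝ)

include h

lemma noiseVar_le_one : C.noiseVar τ ≤ 1 := by
  have h_real : (C.noiseVar τ : ℝ) ≤ 1 := by linarith [C.noiseVar_le τ, h.two_mul_rho_le_quarter]
  exact_mod_cast h_real

include hn

lemma abs_integral_T_sub_G_le {δ : ℝ} (hδ : δ ≤ 1 / 4) (hδγ : δ ≤ γ ^ 2 / 4) :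
    |∫ x, (C.T γ n τ x - G (C.arg τ θ) C.ratio) ∂(gaussianReal θ C.sp)| ≤
      30 * (1 + Real.log n) ^ 2 * Real.exp (-(δ * Real.log n)) := by
  have h_log : 0 ≤ Real.log n := Real.log_natCast_nonneg n
  have h_thr := thr_nonneg h.gamma_pos.le n
  have h_middle := h.measureReal_Icc_mul_abs_integral_clip_hermEst_sub_le (w := C.arg τ θ)
    (C.noiseVar_le τ) h_log C.ratio_mem_Icc hδ (hδγ.trans (by linarith [sq_nonneg γ]))
  rw [Real.exp_log (by exact_mod_cast hn), ← thr] at h_middle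
  simp only [← STrunc_eq_clip] at h_middle
  have h_left := gaussianReal_real_Iio_mul_posMean_le (w := C.arg τ θ)
    (C.noiseVar_le_one h τ) h_thr
  have h_right := gaussianReal_real_Ioi_mul_posMean_neg_le (w := C.arg τ θ)
    (C.noiseVar_le_one h τ) h_thr
  have h_outer : Real.exp (-(thr γ n ^ 2 / 8)) ≤
      (1 + Real.log n) ^ 2 * Real.exp (-(δ * Real.log n)) := by
    have h_thr_sq : thr γ n ^ 2 / 8 = γ ^ 2 / 4 * Real.log n := by
      rw [thr, mul_pow, Real.sq_sqrt (by positivity)]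
      ring
    rw [h_thr_sq]
    refine le_trans ?_ (le_mul_of_one_le_left (Real.exp_pos _).le (one_le_pow₀ (by linarith)))
    gcongr
  rw [C.integral_T_sub_G h.gamma_pos.le]
  refine (abs_add_three _ _ _).trans ?_
  simp only [abs_mul, abs_neg, abs_of_nonneg measureReal_nonneg, abs_of_nonneg (posMean_nonneg _)]
  linarith

lemma integral_T_sub_G_sq_le_mul_exp :
    ∫ x, (C.T γ n τ x - G (C.arg τ θ) C.ratio) ^ 2 ∂(gaussianReal θ C.sp) ≤
      64 * (1 + Real.log n) ^ 2 * Real.exp (3 / 4 * Real.log n) := by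
  have h_log : 0 ≤ Real.log n := Real.log_natCast_nonneg n
  have h_thr := thr_nonneg h.gamma_pos.le n
  have h_middle := h.measureReal_Icc_mul_integral_clip_hermEst_sub_sq_le (w := C.arg τ θ)
    (C.noiseVar_le τ) h_log C.ratio_mem_Icc
  rw [Real.exp_log (by exact_mod_cast hn), ← thr] at h_middle
  simp only [← STrunc_eq_clip] at h_middle
  have h_left := gaussianReal_real_Iio_mul_posMean_sq_le (w := C.arg τ θ)
    (C.noiseVar_le_one h τ) h_thr
  have h_right := gaussianReal_real_Ioi_mul_posMean_neg_sq_le (w := C.arg τ θ)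
    (C.noiseVar_le_one h τ) h_thr
  have h_noise (A : Set ℝ) :
      (gaussianReal (C.arg τ θ) (C.noiseVar τ)).real A * C.noiseVar τ ≤ 1 :=
    mul_le_one₀ measureReal_le_one (NNReal.coe_nonneg _)
      (by exact_mod_cast C.noiseVar_le_one h τ)
  have h_outer : Real.exp (-(thr γ n ^ 2 / 4)) ≤ 1 :=
    Real.exp_le_one_iff.2 (by linarith [sq_nonneg (thr γ n)])
  have h_one : 1 ≤ (1 + Real.log n) ^ 2 * Real.exp (3 / 4 * Real.log n) :=
    one_le_mul_of_one_le_of_one_le (one_le_pow₀ (by linarith)) (Real.one_le_exp (by positivity))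
  refine (C.integral_T_sub_G_sq_le h.gamma_pos.le n τ θ).trans ?_
  simp only [mul_add]
  linarith [h_noise (Set.Iio (-thr γ n)), h_noise (Set.Ioi (thr γ n))]

end Bounds

end Coord

/-! ### The risk -/

lemma map_add_mul_sub_prod_gaussianReal (m₁ m₂ a b : ℝ) (v₁ v₂ : ℝ≥0) :
    ((gaussianReal m₁ v₁).prod (gaussianReal m₂ v₂)).map (fun p => a + b * p.1 - p.2) =
      gaussianReal (a + b * m₁ - m₂) (.mk (b ^ 2) (sq_nonneg b) * v₁ + v₂) := by
  have h_neg : (gaussianReal m₂ v₂).map (fun y => -y) = gaussianReal (-m₂) v₂ :=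
    gaussianReal_map_neg
  rw [show (fun p : ℝ × ℝ => a + b * p.1 - p.2) =
      (fun q => q.1 + q.2) ∘ Prod.map (fun x => a + b * x) (fun y => -y) by
        ext p; simp [sub_eq_add_neg],
    ← Measure.map_map (by fun_prop) (by fun_prop), ← Measure.map_prod_map _ _ (by fun_prop)
      (by fun_prop), map_add_mul_gaussianReal, h_neg, sub_eq_add_neg]
  exact gaussianReal_conv_gaussianReal

namespace Coord

variable (C : Coord) (τ : ℝ≥0∞) (θ : ℝ)

/-- The standard deviation `√(sf + sp α²)` of `q̂(τ) - Y`, for `q̂(τ)` based on the past observation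
and an independent future `Y`. It is the factor by which `ARE` rescales the estimate of `G`. -/
noncomputable def scale : ℝ := √((C.sf : ℝ) + C.sp * C.shrink τ ^ 2)

lemma scale_pos : 0 < C.scale τ := by
  have : (0 : ℝ) < C.sf := C.sf_pos
  exact Real.sqrt_pos.2 (by positivity)

lemma mean_est_sub_div_scale : (C.est τ θ - θ) / C.scale τ = C.arg τ θ := by
  have h_shrink := (C.shrink_mem_Icc τ).1
  have h_c : C.c τ = √((C.sf : ℝ) + C.shrink τ * C.sp) * stdQuantile C.ratio / C.scale τ := by
    rw [c, Real.sqrt_div (by positivity), scale, mul_comm (C.sp : ℝ)]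
    ring
  rw [arg, h_c, d, ← scale, est]
  ring

lemma measurable_est : Measurable (C.est τ) := by
  unfold est
  fun_prop

lemma measurePreserving_est_sub :
    MeasurePreserving (fun p : ℝ × ℝ => C.est τ p.1 - p.2)
      ((gaussianReal θ C.sp).prod (gaussianReal θ C.sf))
      (gaussianReal (C.est τ θ - θ) (.mk (C.scale τ ^ 2) (sq_nonneg _))) where
  measurable := by
    have := C.measurable_est τ
    fun_prop
  map_eq := by
    simp only [est, add_comm (C.shrink τ * _)]
    rw [map_add_mul_sub_prod_gaussianReal]
    congr 1
    ext
    push_cast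
    rw [scale, Real.sq_sqrt (by positivity)]
    ring

lemma loss_eq_integral_checkLoss (q : ℝ) :
    C.loss θ q = ∫ y, checkLoss C.b C.h (q - y) ∂(gaussianReal θ C.sf) := by
  simp only [loss, checkLoss, neg_sub]

lemma integrable_checkLoss_est_sub :
    Integrable (fun p : ℝ × ℝ => checkLoss C.b C.h (C.est τ p.1 - p.2))
      ((gaussianReal θ C.sp).prod (gaussianReal θ C.sf)) :=
  (C.measurePreserving_est_sub τ θ).integrable_comp_of_integrable
    (integrable_checkLoss_gaussianReal _ _ _ _)

lemma integrable_loss_est : Integrable (fun x => C.loss θ (C.est τ x)) (gaussianReal θ C.sp) := by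
  simp only [loss_eq_integral_checkLoss]
  exact (C.integrable_checkLoss_est_sub τ θ).integral_prod_left

lemma integral_loss_est :
    ∫ x, C.loss θ (C.est τ x) ∂(gaussianReal θ C.sp) =
      (C.b + C.h) * C.scale τ * G (C.arg τ θ) C.ratio := by
  have h_preserving := C.measurePreserving_est_sub τ θ
  have h_scale := C.scale_pos τ
  calc ∫ x, C.loss θ (C.est τ x) ∂(gaussianReal θ C.sp)
    _ = ∫ p, checkLoss C.b C.h (C.est τ p.1 - p.2)
          ∂((gaussianReal θ C.sp).prod (gaussianReal θ C.sf)) := by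
        simp only [loss_eq_integral_checkLoss]
        exact (integral_prod _ (C.integrable_checkLoss_est_sub τ θ)).symm
    _ = ∫ t, checkLoss C.b C.h t
          ∂(gaussianReal (C.est τ θ - θ) (.mk (C.scale τ ^ 2) (sq_nonneg _))) := by
        rw [← h_preserving.map_eq, integral_map h_preserving.aemeasurable
          (continuous_checkLoss _ _).aestronglyMeasurable]
    _ = (C.b + C.h) * C.scale τ * G (C.arg τ θ) C.ratio := by
        rw [integral_checkLoss_gaussianReal (add_pos C.b_pos C.h_pos).ne' _
          (ne_of_gt (pow_pos h_scale 2)), NNReal.coe_mk, Real.sqrt_sq h_scale.le,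
          mean_est_sub_div_scale, ratio]

variable {C} in
lemma scale_le {F γ : ℝ} (h : Admissible (C.sp / C.sf) γ) (hF : C.sf ≤ F) :
    C.scale τ ≤ √(2 * F) := by
  obtain ⟨h_nonneg, h_le_one⟩ := C.shrink_mem_Icc τ
  have h_sf : (0 : ℝ) < C.sf := C.sf_pos
  have h_le : (C.sp : ℝ) ≤ C.sf := by
    rw [← div_le_one h_sf]
    linarith [h.two_mul_rho_le_quarter]
  have h_mul : (C.sp : ℝ) * C.shrink τ ^ 2 ≤ C.sp :=
    mul_le_of_le_one_right C.sp.coe_nonneg (pow_le_one₀ h_nonneg h_le_one)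
  exact Real.sqrt_le_sqrt (by linarith)

end Coord

lemma risk_originEst (M : ℕ → Coord) (θ : ℕ → ℝ) (n : ℕ) (τ : ℝ≥0∞) :
    risk M θ n (originEst M n τ) = (1 / n : ℝ) * ∑ i : Fin n,
      ((M i).b + (M i).h) * (M i).scale τ * G ((M i).arg τ (θ i)) (M i).ratio := by
  have h_int (i : Fin n) := (M i).integrable_loss_est τ (θ i)
  have h_int_pi (i : Fin n) : Integrable (fun x : Fin n → ℝ => (M i).loss (θ i) ((M i).est τ (x i)))
      (Measure.pi fun i : Fin n => gaussianReal (θ i) (M i).sp) :=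
    integrable_comp_eval (X := fun _ : Fin n => ℝ) (μ := fun i => gaussianReal (θ i) (M i).sp)
      (h_int i)
  simp only [risk, avgLoss, originEst, pastLaw, ← Coord.integral_loss_est]
  rw [integral_const_mul, integral_finsetSum _ fun i _ => h_int_pi i]
  congr 1
  exact Finset.sum_congr rfl fun i _ => integral_comp_eval (X := fun _ : Fin n => ℝ)
    (μ := fun i => gaussianReal (θ i) (M i).sp) (h_int i).aestronglyMeasurable

lemma ARE_sub_risk (M : ℕ → Coord) (γ θ : ℕ → ℝ) (n : ℕ) (τ : ℝ≥0∞) (x : Fin n → ℝ) :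
    ARE M γ n τ x - risk M θ n (originEst M n τ) = (1 / n : ℝ) * ∑ i : Fin n,
      ((M i).b + (M i).h) * (M i).scale τ *
        ((M i).T (γ i) n τ (x i) - G ((M i).arg τ (θ i)) (M i).ratio) := by
  rw [risk_originEst, ARE, ← mul_sub, ← Finset.sum_sub_distrib]
  simp only [mul_sub, Coord.scale]

/-! ### Averages of independent variables -/

section Averages

variable {ι : Type*} [Fintype ι] {Ω : ι → Type*} {mΩ : ∀ i, MeasurableSpace (Ω i)}
  {P : ∀ i, Measure (Ω i)} [∀ i, IsProbabilityMeasure (P i)] {X : ∀ i, Ω i → ℝ}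

lemma memLp_sum_pi (hX : ∀ i, MemLp (X i) 2 (P i)) :
    MemLp (fun x : ∀ i, Ω i => ∑ i, X i (x i)) 2 (Measure.pi P) :=
  memLp_finsetSum _ fun i _ => (hX i).comp_measurePreserving (measurePreserving_eval P i)

lemma integral_sum_pi_sq (hX : ∀ i, MemLp (X i) 2 (P i)) :
    ∫ x, (∑ i, X i (x i)) ^ 2 ∂(Measure.pi P) =
      ∑ i, Var[X i; P i] + (∑ i, ∫ y, X i y ∂(P i)) ^ 2 := by
  have h_mean : ∫ x, ∑ i, X i (x i) ∂(Measure.pi P) = ∑ i, ∫ y, X i y ∂(P i) := by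
    rw [integral_finsetSum _ fun i _ =>
      integrable_comp_eval ((hX i).integrable one_le_two)]
    exact Finset.sum_congr rfl fun i _ => integral_comp_eval (hX i).aestronglyMeasurable
  have h_var := variance_sum_pi hX
  rw [show (∑ i, fun x : ∀ i, Ω i => X i (x i)) = fun x => ∑ i, X i (x i) by ext; simp,
    variance_eq_sub (memLp_sum_pi hX), h_mean] at h_var
  simp only [Pi.pow_apply] at h_var
  linarith

-- Independence gains a factor `1 / card ι` on the second moments, but none on the biases.
lemma integral_average_pi_sq_le [Nonempty ι] {k : ι → ℝ} {K a b : ℝ}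
    (hX : ∀ i, MemLp (X i) 2 (P i)) (hk : ∀ i, |k i| ≤ K) (ha : ∀ i, |∫ y, X i y ∂(P i)| ≤ a)
    (hb : ∀ i, ∫ y, X i y ^ 2 ∂(P i) ≤ b) :
    ∫ x, ((1 / Fintype.card ι : ℝ) * ∑ i, k i * X i (x i)) ^ 2 ∂(Measure.pi P) ≤
      K ^ 2 * (b / Fintype.card ι + a ^ 2) := by
  set N : ℝ := (Fintype.card ι : ℝ)
  have hN : 0 < N := Nat.cast_pos.2 Fintype.card_pos
  have hK : 0 ≤ K := (abs_nonneg _).trans (hk (Classical.arbitrary ι))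
  have h_var : ∑ i, Var[fun y => k i * X i y; P i] ≤ N * (K ^ 2 * b) := by
    refine (Finset.sum_le_card_nsmul _ _ (K ^ 2 * b) fun i _ => ?_).trans_eq
      (by rw [nsmul_eq_mul, Finset.card_univ])
    rw [variance_const_mul, ← sq_abs]
    have := (variance_le_expectation_sq (hX i).aestronglyMeasurable).trans (hb i)
    gcongr
    exacts [variance_nonneg _ _, hk i]
  have h_mean : |∑ i, ∫ y, k i * X i y ∂(P i)| ≤ N * (K * a) := by
    refine (Finset.abs_sum_le_sum_abs _ _).trans <|
      (Finset.sum_le_card_nsmul _ _ (K * a) fun i _ => ?_).trans_eq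
        (by rw [nsmul_eq_mul, Finset.card_univ])
    rw [integral_const_mul, abs_mul]
    gcongr
    exacts [hk i, ha i]
  simp only [mul_pow]
  rw [integral_const_mul, integral_sum_pi_sq fun i => (hX i).const_mul (k i), ← sq_abs (∑ i, _)]
  calc (1 / N) ^ 2 * (∑ i, Var[fun y => k i * X i y; P i] + |∑ i, ∫ y, k i * X i y ∂(P i)| ^ 2)
    _ ≤ (1 / N) ^ 2 * (N * (K ^ 2 * b) + (N * (K * a)) ^ 2) := by gcongr
    _ = K ^ 2 * (b / N + a ^ 2) := by field_simp

end Averages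

/-! ### Uniform approximation of the risk -/

lemma AdmissibleThresholds.exists_le_and_admissible {M : ℕ → Coord} {γ : ℕ → ℝ}
    (h : AdmissibleThresholds M γ) :
    ∃ l, 0 < l ∧ ∀ i, l ≤ γ i ∧ Admissible ((M i).sp / (M i).sf) (γ i) := by
  obtain ⟨⟨l, hl, hlγ⟩, h_lt⟩ := h
  exact ⟨l, hl, fun i => ⟨hlγ i, div_pos (M i).sp_pos (M i).sf_pos, hl.trans_le (hlγ i),
    by linarith [h_lt i]⟩⟩

lemma sq_rates_le {δ ℓ : ℝ} (hℓ : 0 ≤ ℓ) (hδ : 0 ≤ δ) (hδ' : δ ≤ 1 / 4) :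
    64 * (1 + ℓ) ^ 2 * Real.exp (3 / 4 * ℓ) / Real.exp ℓ +
        (30 * (1 + ℓ) ^ 2 * Real.exp (-(δ * ℓ))) ^ 2 ≤
      964 * ((1 + ℓ) ^ 4 * Real.exp (-(δ * ℓ))) := by
  have h_var : (1 + ℓ) ^ 2 * Real.exp (3 / 4 * ℓ - ℓ) ≤ (1 + ℓ) ^ 4 * Real.exp (-(δ * ℓ)) := by
    gcongr
    · linarith
    · norm_num
    · nlinarith
  have h_bias : Real.exp (-(δ * ℓ)) ^ 2 ≤ Real.exp (-(δ * ℓ)) :=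
    pow_le_of_le_one (Real.exp_pos _).le (Real.exp_le_one_iff.2 (by nlinarith)) two_ne_zero
  calc _ = 64 * ((1 + ℓ) ^ 2 * Real.exp (3 / 4 * ℓ - ℓ)) +
        900 * ((1 + ℓ) ^ 4 * Real.exp (-(δ * ℓ)) ^ 2) := by rw [Real.exp_sub]; ring
    _ ≤ 64 * ((1 + ℓ) ^ 4 * Real.exp (-(δ * ℓ))) +
        900 * ((1 + ℓ) ^ 4 * Real.exp (-(δ * ℓ))) := by gcongr
    _ = _ := by ring

lemma integral_sq_ARE_sub_risk_le {M : ℕ → Coord} {γ : ℕ → ℝ} (θ : ℕ → ℝ) {B F δ : ℝ}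
    (hB : ∀ i, (M i).b + (M i).h ≤ B) (hF : ∀ i, ((M i).sf : ℝ) ≤ F)
    (hγ : ∀ i, Admissible ((M i).sp / (M i).sf) (γ i)) (hδ : 0 ≤ δ) (hδ' : δ ≤ 1 / 4)
    (hδγ : ∀ i, δ ≤ γ i ^ 2 / 4) {n : ℕ} (hn : 1 ≤ n) (τ : ℝ≥0∞) :
    ∫ x, (ARE M γ n τ x - risk M θ n (originEst M n τ)) ^ 2 ∂(pastLaw M θ n) ≤
      (B * √(2 * F)) ^ 2 * (964 * ((1 + Real.log n) ^ 4 * Real.exp (-(δ * Real.log n)))) := by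
  have : Nonempty (Fin n) := ⟨⟨0, hn⟩⟩
  have h_weight (i : Fin n) : |((M i).b + (M i).h) * (M i).scale τ| ≤ B * √(2 * F) := by
    have h_pos := add_pos (M i).b_pos (M i).h_pos
    rw [abs_of_pos (mul_pos h_pos ((M i).scale_pos τ))]
    exact mul_le_mul (hB i) (Coord.scale_le τ (hγ i) (hF i)) ((M i).scale_pos τ).le
      (h_pos.le.trans (hB i))
  have h_average := integral_average_pi_sq_le
    (fun i : Fin n => ((M i).memLp_T (hγ i).gamma_pos.le n τ (θ i)).sub (memLp_const _)) h_weight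
    (fun i => (M i).abs_integral_T_sub_G_le (hγ i) hn τ (θ i) hδ' (hδγ i))
    (fun i => (M i).integral_T_sub_G_sq_le_mul_exp (hγ i) hn τ (θ i))
  simp only [ARE_sub_risk]
  rw [Fintype.card_fin] at h_average
  refine h_average.trans (mul_le_mul_of_nonneg_left ?_ (sq_nonneg _))
  have h_rates := sq_rates_le (Real.log_natCast_nonneg n) hδ hδ'
  rwa [Real.exp_log (by exact_mod_cast hn)] at h_rates

lemma memLp_ARE_sub_risk {M : ℕ → Coord} {γ : ℕ → ℝ} (hγ : ∀ i, 0 ≤ γ i) (θ : ℕ → ℝ) (n : ℕ)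
    (τ : ℝ≥0∞) :
    MemLp (fun x => ARE M γ n τ x - risk M θ n (originEst M n τ)) 2 (pastLaw M θ n) := by
  simp only [ARE_sub_risk]
  exact (memLp_sum_pi fun i : Fin n => (((M i).memLp_T (hγ i) n τ (θ i)).sub
    (memLp_const _)).const_mul _).const_mul _

lemma tendsto_log_pow_mul_exp_neg_mul_atTop {δ : ℝ} (hδ : 0 < δ) :
    Tendsto (fun t : ℝ => Real.log t ^ 8 * ((1 + t) ^ 4 * Real.exp (-(δ * t)))) atTop (𝓝 0) := by
  have h_pow := (tendsto_rpow_mul_exp_neg_mul_atTop_nhds_zero 12 δ hδ).const_mul 16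
  rw [mul_zero] at h_pow
  refine squeeze_zero' (Eventually.of_forall fun t => by positivity) ?_ h_pow
  filter_upwards [eventually_ge_atTop 1] with t ht
  have h_log_nonneg := Real.log_nonneg ht
  have h_log_le := Real.log_le_self (zero_le_one.trans ht)
  calc Real.log t ^ 8 * ((1 + t) ^ 4 * Real.exp (-(δ * t)))
    _ ≤ t ^ 8 * ((2 * t) ^ 4 * Real.exp (-(δ * t))) := by gcongr; linarith
    _ = 16 * (t ^ (12 : ℕ) * Real.exp (-δ * t)) := by rw [neg_mul]; ring
    _ = 16 * (t ^ (12 : ℝ) * Real.exp (-δ * t)) := by rw [← Real.rpow_natCast t 12]; norm_num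

end CheckLoss

open CheckLoss in
theorem mainTheorem1_general (M : ℕ → Coord) (γ θ : ℕ → ℝ) {B F : ℝ}
    (hB : ∀ i, (M i).b + (M i).h ≤ B) (hF : ∀ i, ((M i).sf : ℝ) ≤ F)
    (hγ : AdmissibleThresholds M γ) :
    Tendsto (fun n : ℕ => ENNReal.ofReal (Real.log (Real.log n) ^ 8) *
        ⨆ τ : ℝ≥0∞, ∫⁻ x, ENNReal.ofReal ((ARE M γ n τ x - risk M θ n (originEst M n τ)) ^ 2)
          ∂(pastLaw M θ n))
      atTop (𝓝 0) := by
  obtain ⟨l, hl, hγl⟩ := hγ.exists_le_and_admissible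
  obtain ⟨δ, hδ, hδ'⟩ : ∃ δ : ℝ, 0 < δ ∧ δ ≤ min (1 / 4) (l ^ 2 / 4) :=
    ⟨_, by positivity, le_rfl⟩
  obtain ⟨hδ4, hδl⟩ := le_min_iff.1 hδ'
  have hδγ (i : ℕ) : δ ≤ γ i ^ 2 / 4 := hδl.trans (by have := (hγl i).1; gcongr)
  have h_lim := ENNReal.tendsto_ofReal (((tendsto_log_pow_mul_exp_neg_mul_atTop hδ).comp
    (Real.tendsto_log_atTop.comp tendsto_natCast_atTop_atTop)).const_mul
      ((B * √(2 * F)) ^ 2 * 964))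
  rw [mul_zero, ENNReal.ofReal_zero] at h_lim
  refine tendsto_of_tendsto_of_tendsto_of_le_of_le' tendsto_const_nhds h_lim
    (Eventually.of_forall fun n => zero_le) ?_
  filter_upwards [eventually_ge_atTop 1] with n hn
  have h_bound (τ : ℝ≥0∞) :=
    integral_sq_ARE_sub_risk_le θ hB hF (fun i => (hγl i).2) hδ.le hδ4 hδγ hn τ
  rw [Function.comp_apply, Function.comp_apply, mul_left_comm, ENNReal.ofReal_mul (by positivity),
    mul_assoc]
  gcongr
  refine iSup_le fun τ => ?_
  rw [← ofReal_integral_eq_lintegral_ofReal (memLp_ARE_sub_risk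
    (fun i => (hγl i).2.gamma_pos.le) θ n τ).integrable_sq (ae_of_all _ fun x => sq_nonneg _)]
  exact ENNReal.ofReal_le_ofReal (h_bound τ)

open CheckLoss in
theorem mainTheorem1 (M : ℕ → Coord) (γ θ : ℕ → ℝ)
    (hA1 : BoundedWeights M) (hA2 : BoundedMeans θ) (hA3 : SufficientData M)
    (hγ : AdmissibleThresholds M γ) :
    Tendsto (fun n : ℕ => ENNReal.ofReal (Real.log (Real.log n) ^ 8) *
        ⨆ τ : ℝ≥0∞, ∫⁻ x, ENNReal.ofReal ((ARE M γ n τ x - risk M θ n (originEst M n τ)) ^ 2)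
          ∂(pastLaw M θ n))
      atTop (𝓝 0) := by
  obtain ⟨-, -, B, hB⟩ := hA1
  obtain ⟨-, ⟨F, hF⟩, -⟩ := hA3
  exact mainTheorem1_general M γ θ hB hF hγ
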